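/- Let $G\subset \mathrm{GL}(n,\mathbb{C})$ be a complex reflection group, i.e. a finite subgroup generated by the elements $g \in G$ for which $g-1$ has rank one. Let $\mathbb{C}^n/G=\operatorname{Spec}\mathbb{C}[x_1,\dots,x_n]^G$ be the quotient variety and $p:\mathbb{C}^n\to\mathbb{C}^n/G$ the quotient morphism. For a field $K \supseteq \mathbb{C}$, a $G$-cluster over $K$ is a $G$-invariant closed subscheme $Z\subset\mathbb{C}^n_K$ such that $H^0(Z,\mathcal{O}_Z)\cong K[G]$ as representations of $G$ over $K$. For a locally Noetherian scheme $S$ over $\mathbb{C}$, a flat family of $G$-clusters parametrized by $S$ is a $G$-invariant closed subscheme $\mathcal{Z}\subset S\times\mathbb{C}^n$, finite and flat over $S$, whose fibre over each point $s\in S$ is a $G$-cluster over the residue field $\kappa(s)$; let $h(S)$ be the set of these closed subschemes. The $G$-Hilbert scheme $G\text{-}\mathrm{Hilb}(\mathbb{C}^n)$ is the locally Noetherian $\mathbb{C}$-scheme $X$, equipped with a universal family $\mathcal{U}\in h(X)$, that represents $h$: for every locally Noetherian scheme $S$ over $\mathbb{C}$, the assignment $f\mapsto (f\times\mathrm{id})^{-1}\,\mathcal{U}$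 is a bijection from $\operatorname{Hom}_{\mathbb{C}}(S,X)$ onto $h(S)$. Then $$G\text{-}\mathrm{Hilb}(\mathbb{C}^n)\cong\mathbb{C}^n/G$$ as schemes over $\mathbb{C}$. More precisely, $\mathbb{C}^n/G$ represents $h$, with universal family the closed subscheme $\mathbb{C}^n\hookrightarrow \mathbb{C}^n/G\times\mathbb{C}^n$ embedded by $(p,\mathrm{id})$; and for every pair $(X,\mathcal{U})$ representing $h$ there is a unique isomorphism $X\cong\mathbb{C}^n/G$ over $\mathbb{C}$ that pulls this family back to $\mathcal{U}$. -/

import Mathlib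

open AlgebraicGeometry CategoryTheory CategoryTheory.Limits

noncomputable section

namespace GHilb

/-! ### Complex reflection groups -/

/-- A (pseudo)reflection of `ℂⁿ`: an invertible linear map `g` such that `g - 1` has rank one,
i.e. whose fixed locus is a hyperplane. (In a finite group it automatically has finite order.) -/
def IsReflection {n : ℕ} (g : GL (Fin n) ℂ) : Prop :=
  ((g : Matrix (Fin n) (Fin n) ℂ) - 1).rank = 1

/-- A complex reflection group: a finite subgroup of `GL(n, ℂ)` generated by the reflections
it contains. -/
def IsComplexReflectionGroup {n : ℕ} (G : Subgroup (GL (Fin n) ℂ)) : Prop :=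
  Finite G ∧ Subgroup.closure {g : GL (Fin n) ℂ | g ∈ G ∧ IsReflection g} = G

/-! ### The affine space `ℂⁿ`, the linear action on it, and the quotient variety `ℂⁿ/G` -/

/-- The linear change of variables `f ↦ f ∘ A` on polynomial functions on `ℂⁿ`. -/
def linSubst {n : ℕ} (A : Matrix (Fin n) (Fin n) ℂ) :
    MvPolynomial (Fin n) ℂ →ₐ[ℂ] MvPolynomial (Fin n) ℂ :=
  MvPolynomial.aeval fun i => ∑ j, MvPolynomial.C (A i j) * MvPolynomial.X j

/-- As a function on `ℂⁿ`, `linSubst A f` is `v ↦ f (A v)`. -/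
theorem eval_linSubst {n : ℕ} (A : Matrix (Fin n) (Fin n) ℂ) (f : MvPolynomial (Fin n) ℂ)
    (v : Fin n → ℂ) :
    MvPolynomial.eval v (linSubst A f) = MvPolynomial.eval (A.mulVec v) f := by
  induction f using MvPolynomial.induction_on with
  | C a => simp [linSubst]
  | add p q hp hq => simp [hp, hq]
  | mul_X p i hp => simp [hp]; simp [linSubst, Matrix.mulVec, dotProduct]

/-- The ring `ℂ[x₁, …, xₙ]^G` of invariant polynomials. -/
def invariants {n : ℕ} (G : Subgroup (GL (Fin n) ℂ)) : Subalgebra ℂ (MvPolynomial (Fin n) ℂ) where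
  carrier := {f | ∀ g ∈ G, linSubst (g : Matrix (Fin n) (Fin n) ℂ) f = f}
  mul_mem' ha hb g hg := by rw [map_mul, ha g hg, hb g hg]
  add_mem' ha hb g hg := by rw [map_add, ha g hg, hb g hg]
  algebraMap_mem' r g _ := AlgHom.commutes _ r

/-- The base `Spec ℂ`. Schemes over `ℂ` are objects of `Over SpecC`. -/
abbrev SpecC : Scheme.{0} := Spec (CommRingCat.of ℂ)

/-- The affine space `ℂⁿ = Spec ℂ[x₁, …, xₙ]` over `ℂ`. -/
def affineSpace (n : ℕ) : Over SpecC :=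
  Over.mk (Spec.map (CommRingCat.ofHom (algebraMap ℂ (MvPolynomial (Fin n) ℂ))))

/-- The linear endomorphism `v ↦ A v` of the scheme `ℂⁿ`. -/
def linMap {n : ℕ} (A : Matrix (Fin n) (Fin n) ℂ) : affineSpace n ⟶ affineSpace n :=
  Over.homMk (Spec.map (CommRingCat.ofHom (linSubst A).toRingHom)) (by
    simp only [affineSpace, Over.mk_hom, ← Spec.map_comp, ← CommRingCat.ofHom_comp]
    congr 2
    exact (linSubst A).comp_algebraMap)

/-- The quotient variety `ℂⁿ/G = Spec ℂ[x₁, …, xₙ]^G` over `ℂ`. -/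
def quotientVariety {n : ℕ} (G : Subgroup (GL (Fin n) ℂ)) : Over SpecC :=
  Over.mk (Spec.map (CommRingCat.ofHom (algebraMap ℂ (invariants G))))

/-- The quotient morphism `ℂⁿ ⟶ ℂⁿ/G`. -/
def quotientMap {n : ℕ} (G : Subgroup (GL (Fin n) ℂ)) : affineSpace n ⟶ quotientVariety G :=
  Over.homMk (Spec.map (CommRingCat.ofHom (invariants G).val.toRingHom)) (by
    simp only [affineSpace, quotientVariety, Over.mk_hom, ← Spec.map_comp,
      ← CommRingCat.ofHom_comp]
    congr 2)

/-! ### Families of subschemes of `ℂⁿ` -/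

/-- The product `S ×_ℂ ℂⁿ`. -/
abbrev prodAffine (n : ℕ) (S : Over SpecC) : Scheme.{0} := pullback S.hom (affineSpace n).hom

/-- The morphism `f × id : T × ℂⁿ ⟶ S × ℂⁿ`. -/
def baseChange (n : ℕ) {T S : Over SpecC} (f : T ⟶ S) : prodAffine n T ⟶ prodAffine n S :=
  pullback.map _ _ _ _ f.left (𝟙 _) (𝟙 _) (by simp) (by simp)

/-- The morphism `id × A : S × ℂⁿ ⟶ S × ℂⁿ` for a matrix `A`. -/
def actProd {n : ℕ} (S : Over SpecC) (A : Matrix (Fin n) (Fin n) ℂ) :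
    prodAffine n S ⟶ prodAffine n S :=
  pullback.map _ _ _ _ (𝟙 _) (linMap A).left (𝟙 _) (by simp) (by simp)

/-- The projection to `S` of the closed subscheme `Z ⊆ S × ℂⁿ` with ideal sheaf `I`. -/
def proj {n : ℕ} {S : Over SpecC} (I : (prodAffine n S).IdealSheafData) : I.subscheme ⟶ S.left :=
  I.subschemeι ≫ pullback.fst S.hom (affineSpace n).hom

/-- The closed subscheme `Z ⊆ S × ℂⁿ` with ideal sheaf `I` is `G`-invariant: `(id × g)⁻¹ Z = Z` for
all `g ∈ G`. -/
def IsInvariant {n : ℕ} (G : Subgroup (GL (Fin n) ℂ)) {S : Over SpecC}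
    (I : (prodAffine n S).IdealSheafData) : Prop :=
  ∀ g ∈ G, I.comap (actProd S (g : Matrix (Fin n) (Fin n) ℂ)) = I

/-- The morphism `Z ⟶ Z` induced by `id × g` on a `G`-invariant closed subscheme `Z ⊆ S × ℂⁿ`. -/
def actSub {n : ℕ} {G : Subgroup (GL (Fin n) ℂ)} {S : Over SpecC}
    {I : (prodAffine n S).IdealSheafData} (hI : IsInvariant G I) (g : G) :
    I.subscheme ⟶ I.subscheme :=
  Scheme.IdealSheafData.subschemeMap I I (actProd S ((g : GL (Fin n) ℂ) : Matrix (Fin n) (Fin n) ℂ))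
    (Scheme.IdealSheafData.le_map_iff_comap_le.mpr (hI g g.2).le)

/-- A `G`-cluster over a field extension `K` of `ℂ` (given by `t : Spec K ⟶ Spec ℂ`): a
`G`-invariant closed subscheme `Z` of `ℂⁿ_K` such that `H⁰(Z, 𝒪_Z)` is isomorphic, as a
representation of `G` over `K`, to the regular representation `K[G]`. Here `c ∈ K` acts on
functions through the projection `Z ⟶ Spec K`, and `g ∈ G` acts by `f ↦ f ∘ g⁻¹`. -/
def IsCluster {n : ℕ} (G : Subgroup (GL (Fin n) ℂ)) (K : CommRingCat.{0}) (t : Spec K ⟶ SpecC)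
    (J : (prodAffine n (Over.mk t)).IdealSheafData) : Prop :=
  ∃ hJ : IsInvariant G J, ∃ φ : Γ(J.subscheme, ⊤) ≃+ MonoidAlgebra K G,
    (∀ (c : K) (f : Γ(J.subscheme, ⊤)),
      φ ((proj J).appTop.hom ((Scheme.ΓSpecIso K).inv.hom c) * f) = c • φ f) ∧
    (∀ (g : G) (f : Γ(J.subscheme, ⊤)),
      φ ((actSub hJ g⁻¹).appTop.hom f) = MonoidAlgebra.single g 1 * φ f)

/-- The inclusion `Spec κ(s) ⟶ S` of a point, as a morphism over `ℂ`. -/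
def pointMap (S : Over SpecC) (s : S.left) :
    Over.mk (S.left.fromSpecResidueField s ≫ S.hom) ⟶ S :=
  Over.homMk (S.left.fromSpecResidueField s) (by simp)

/-- A flat family of `G`-clusters parametrized by `S`: a `G`-invariant closed subscheme
`Z ⊆ S × ℂⁿ` (given by its ideal sheaf `I`), finite and flat over `S`, whose fibre over each
point `s` of `S` is a `G`-cluster over the residue field `κ(s)`. -/
structure IsClusterFamily {n : ℕ} (G : Subgroup (GL (Fin n) ℂ)) (S : Over SpecC)
    (I : (prodAffine n S).IdealSheafData) : Prop where
  invariant : IsInvariant G I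
  finite : IsFinite (proj I)
  flat : Flat (proj I)
  fibre : ∀ s : S.left, IsCluster G (S.left.residueField s)
    (S.left.fromSpecResidueField s ≫ S.hom) (I.comap (baseChange n (pointMap S s)))

/-- `(X, 𝒵)` is the `G`-Hilbert scheme `G`-Hilb(`ℂⁿ`) with its universal family: `X` is a locally
Noetherian scheme over `ℂ`, and for each locally Noetherian scheme `S` over `ℂ` pulling back the
closed subscheme `𝒵 ⊆ X × ℂⁿ` is a bijection from the set of `ℂ`-morphisms `S ⟶ X` onto the set
of flat families of `G`-clusters parametrized by `S`. -/
structure IsGHilbertScheme {n : ℕ} (G : Subgroup (GL (Fin n) ℂ)) (X : Over SpecC)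
    (Z : (prodAffine n X).IdealSheafData) : Prop where
  locallyNoetherian : IsLocallyNoetherian X.left
  bijOn : ∀ S : Over SpecC, IsLocallyNoetherian S.left →
    Set.BijOn (fun f : S ⟶ X => Z.comap (baseChange n f)) Set.univ
      {I | IsClusterFamily G S I}

/-- The closed subscheme `ℂⁿ ⊆ ℂⁿ/G × ℂⁿ`, namely the image of the closed immersion `(p, id)`
with `p : ℂⁿ ⟶ ℂⁿ/G` the quotient morphism. -/
def quotientFamily {n : ℕ} (G : Subgroup (GL (Fin n) ℂ)) :
    (prodAffine n (quotientVariety G)).IdealSheafData :=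
  (pullback.lift (f := (quotientVariety G).hom) (g := (affineSpace n).hom)
    (quotientMap G).left (𝟙 _) (by simp)).ker

end GHilb

end

noncomputable section

namespace GHilb

open TensorProduct

/-! ### Averaging, and finiteness over the ring of invariants -/

section Invariants

variable {n : ℕ}

/-! Write `R` for the invariants and `P` for the polynomial ring. The proof shows that `R → P` is a
finite flat family of regular representations, and that every other such family embedded in affine
space is a base change of it.

Finiteness follows from integrality over the invariants. Flatness is where reflections enter
(`flat_of_isComplexReflectionGroup`): a reflection `g` satisfies `g f = f + l * D f`, with `D` an
`R`-linear operator that lowers degree. If `x` lies in the kernel of `P ⊗ N → P ⊗ N'` with `N → N'`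
injective, then by induction on degree every `D x` vanishes, so `x` is fixed by `G`. Hence `x`
equals its average, which comes from the kernel of `N → N'`, and that kernel is zero.

Now `P` is projective over `R`, so traces make sense. A nontrivial `g` has trace zero because a
nonzero multiple of it is a commutator; the averaging projector has trace one, so each fibre has
dimension the order of `G`. By character theory in characteristic zero, each fibre is the regular
representation (`exists_fibre_equiv_monoidAlgebra`), and pullbacks of the quotient family are
families of clusters.

Conversely, let `B` over `A` be an affine family. The invariants of a regular representation form a
line, so the invariants of `B` are just `A` (`HasRegularFibres.mem_range_of_invariant`), and `R → P
→ B` lands in `A`. The induced map `A ⊗ P → B` is surjective because `B` comes from a closed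
subscheme, and its two sides have equal fibre dimensions with `B` projective, so it is an
isomorphism (`isPushout_of_hasRegularFibres`). Faithfully flat descent along the family turns these
local classifying maps into a global one (`exists_comap_quotientFamily_eq`), and the same flatness
gives its uniqueness. Uniqueness of the representing pair is the Yoneda argument. -/

theorem linSubst_one (f : MvPolynomial (Fin n) ℂ) : linSubst 1 f = f :=
  MvPolynomial.funext fun v => by simp [eval_linSubst]

theorem linSubst_linSubst (A B : Matrix (Fin n) (Fin n) ℂ) (f : MvPolynomial (Fin n) ℂ) :
    linSubst A (linSubst B f) = linSubst (B * A) f :=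
  MvPolynomial.funext fun v => by simp [eval_linSubst]

theorem totalDegree_linSubst_le (A : Matrix (Fin n) (Fin n) ℂ) (f : MvPolynomial (Fin n) ℂ) :
    (linSubst A f).totalDegree ≤ f.totalDegree := by
  rw [linSubst, MvPolynomial.aeval_def, MvPolynomial.eval₂_eq]
  refine MvPolynomial.totalDegree_finsetSum_le fun d hd => ?_
  refine (MvPolynomial.totalDegree_mul _ _).trans ?_
  rw [MvPolynomial.algebraMap_eq, MvPolynomial.totalDegree_C, zero_add]
  refine (MvPolynomial.totalDegree_finsetProd _ _).trans ?_
  refine le_trans (Finset.sum_le_sum fun i _ => ?_) (MvPolynomial.le_totalDegree hd)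
  refine (MvPolynomial.totalDegree_pow _ _).trans ?_
  refine mul_le_of_le_one_right (Nat.zero_le _) ?_
  refine MvPolynomial.totalDegree_finsetSum_le fun j _ => ?_
  refine (MvPolynomial.totalDegree_mul _ _).trans ?_
  simp [MvPolynomial.totalDegree_C, MvPolynomial.totalDegree_X]

variable (G : Subgroup (GL (Fin n) ℂ))

/-- Substitution by an element of `G`, as an endomorphism over the ring of invariants. -/
def groupSubst (g : G) :
    MvPolynomial (Fin n) ℂ →ₐ[invariants G] MvPolynomial (Fin n) ℂ where
  toRingHom := (linSubst ((g : GL (Fin n) ℂ) : Matrix (Fin n) (Fin n) ℂ)).toRingHom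
  commutes' r := r.2 g g.2

theorem groupSubst_apply (g : G) (f : MvPolynomial (Fin n) ℂ) :
    groupSubst G g f = linSubst ((g : GL (Fin n) ℂ) : Matrix (Fin n) (Fin n) ℂ) f := rfl

theorem groupSubst_one : groupSubst G 1 = AlgHom.id _ _ :=
  AlgHom.ext fun f => linSubst_one f

/-- Substitution is a right action, which is why inverses appear whenever a left action or a
representation is required. -/
theorem groupSubst_mul (g h : G) :
    groupSubst G (g * h) = (groupSubst G h).comp (groupSubst G g) :=
  AlgHom.ext fun f => (linSubst_linSubst _ _ f).symm

theorem groupSubst_eq_id_iff (g : G) : groupSubst G g = AlgHom.id _ _ ↔ g = 1 := by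
  refine ⟨fun h => ?_, fun h => h ▸ groupSubst_one G⟩
  ext i j
  -- The coordinate `X i` evaluated at the `j`-th basis vector reads off the matrix entry, so the
  -- action on polynomials is faithful.
  have h1 := congrArg (MvPolynomial.eval (Pi.single j (1 : ℂ)))
    (DFunLike.congr_fun h (MvPolynomial.X i))
  rw [groupSubst_apply, eval_linSubst] at h1
  simpa [Matrix.mulVec, dotProduct, Pi.single_apply, Matrix.one_apply] using h1

variable [Finite G]

/-- The inverse of the order of `G`, as an invariant polynomial. -/
def invCard : invariants G := algebraMap ℂ (invariants G) (Nat.card G : ℂ)⁻¹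

theorem invCard_smul_card_smul {M : Type*} [AddCommGroup M] [Module (invariants G) M] (m : M) :
    invCard G • (Nat.card G • m) = m := by
  have : invCard G * (Nat.card G : invariants G) = 1 := by
    rw [invCard, ← map_natCast (algebraMap ℂ (invariants G)), ← map_mul, inv_mul_cancel₀, map_one]
    exact_mod_cast Nat.card_pos.ne'
  rw [← Nat.cast_smul_eq_nsmul (invariants G), smul_smul, this, one_smul]

/-- The averaging operator of the polynomial ring. -/
def average : MvPolynomial (Fin n) ℂ →ₗ[invariants G] MvPolynomial (Fin n) ℂ :=
  let _ := Fintype.ofFinite G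
  invCard G • ∑ g : G, (groupSubst G g).toLinearMap

theorem average_eq [Fintype G] :
    average G = invCard G • ∑ g : G, (groupSubst G g).toLinearMap := by
  have : Fintype.ofFinite G = ‹_› := Subsingleton.elim _ _
  subst this
  rfl

theorem groupSubst_comp_average (h : G) :
    (groupSubst G h).toLinearMap ∘ₗ average G = average G := by
  let _ := Fintype.ofFinite G
  rw [average_eq, LinearMap.comp_smul,
    show (groupSubst G h).toLinearMap ∘ₗ ∑ g, (groupSubst G g).toLinearMap =
      ∑ g, (groupSubst G h).toLinearMap ∘ₗ (groupSubst G g).toLinearMap from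
      map_sum (LinearMap.llcomp (invariants G) _ _ _ (groupSubst G h).toLinearMap) _ _]
  refine congrArg (invCard G • ·) (?_ : _ = _)
  refine Fintype.sum_equiv (Equiv.mulRight h) _ _ fun g => ?_
  rw [Equiv.coe_mulRight, groupSubst_mul, AlgHom.comp_toLinearMap]

/-- The averaging operator, as a retraction onto the invariant polynomials. -/
def reynolds : MvPolynomial (Fin n) ℂ →ₗ[invariants G] invariants G where
  toFun f := ⟨average G f, fun g hg => DFunLike.congr_fun (groupSubst_comp_average G ⟨g, hg⟩) f⟩
  map_add' x y := Subtype.ext (map_add (average G) x y)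
  map_smul' r x := Subtype.ext (map_smul (average G) r x)

theorem linearMap_comp_reynolds :
    Algebra.linearMap (invariants G) (MvPolynomial (Fin n) ℂ) ∘ₗ reynolds G = average G := rfl

theorem reynolds_comp_linearMap :
    reynolds G ∘ₗ Algebra.linearMap (invariants G) (MvPolynomial (Fin n) ℂ) = LinearMap.id := by
  let _ := Fintype.ofFinite G
  refine LinearMap.ext fun r => Subtype.ext ?_
  change average G r = r
  have (g : G) : (groupSubst G g).toLinearMap (r : MvPolynomial (Fin n) ℂ) = r := r.2 g g.2
  rw [average_eq, LinearMap.smul_apply, LinearMap.sum_apply]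
  simp only [this, Finset.sum_const, Finset.card_univ, ← Nat.card_eq_fintype_card]
  exact invCard_smul_card_smul G _

instance : Algebra.IsIntegral (invariants G) (MvPolynomial (Fin n) ℂ) := by
  let _ : MulSemiringAction G (MvPolynomial (Fin n) ℂ) :=
    { smul := fun g f => groupSubst G g⁻¹ f
      one_smul := fun f => by
        change groupSubst G 1⁻¹ f = f
        rw [inv_one, groupSubst_one]; rfl
      mul_smul := fun g h f => by
        change groupSubst G (g * h)⁻¹ f = groupSubst G g⁻¹ (groupSubst G h⁻¹ f)
        rw [mul_inv_rev, groupSubst_mul]; rfl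
      smul_zero := fun g => map_zero (groupSubst G g⁻¹)
      smul_add := fun g => map_add (groupSubst G g⁻¹)
      smul_one := fun g => map_one (groupSubst G g⁻¹)
      smul_mul := fun g => map_mul (groupSubst G g⁻¹) }
  have : Algebra.IsInvariant (invariants G) (MvPolynomial (Fin n) ℂ) G :=
    ⟨fun b hb => ⟨⟨b, fun g hg => by
      have := hb ⟨g, hg⟩⁻¹
      change groupSubst G (⟨g, hg⟩⁻¹)⁻¹ b = b at this
      rwa [inv_inv] at this⟩, rfl⟩⟩
  exact Algebra.IsInvariant.isIntegral (invariants G) (MvPolynomial (Fin n) ℂ) G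

instance : Module.Finite (invariants G) (MvPolynomial (Fin n) ℂ) :=
  have : Algebra.FiniteType (invariants G) (MvPolynomial (Fin n) ℂ) :=
    Algebra.FiniteType.of_restrictScalars_finiteType ℂ _ _
  Algebra.IsIntegral.finite

/-- The Artin–Tate lemma: `P` is of finite type over `ℂ` and finite over the invariants, so the
invariants are of finite type over `ℂ`. -/
instance : IsNoetherianRing (invariants G) := by
  have : Algebra.FiniteType ℂ (invariants G) :=
    ⟨fg_of_fg_of_fg ℂ (invariants G) (MvPolynomial (Fin n) ℂ) Algebra.FiniteType.out
      Module.Finite.fg_top (FaithfulSMul.algebraMap_injective _ _)⟩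
  exact Algebra.FiniteType.isNoetherianRing ℂ _

end Invariants

/-! ### Difference operators of reflections, and flatness -/

section Demazure

/-- All columns are multiples of one vector spanning the image. For a reflection this supplies the
linear form `w` that cuts out the hyperplane and the direction `u` of displacement. -/
theorem exists_eq_vecMulVec_of_rank_eq_one {m n K : Type*} [Fintype m] [Fintype n] [Field K]
    {A : Matrix m n K} (hA : A.rank = 1) : ∃ u w, A = Matrix.vecMulVec u w := by
  classical
  obtain ⟨u, -, hu⟩ := finrank_eq_one_iff'.mp hA
  choose w hw using fun j => hu ⟨A.mulVecLin (Pi.single j 1), LinearMap.mem_range_self _ _⟩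
  refine ⟨u, w, Matrix.ext fun i j => ?_⟩
  have := congrFun (congrArg Subtype.val (hw j)) i
  simp only [Submodule.coe_smul, Pi.smul_apply, smul_eq_mul, Matrix.mulVecLin_apply,
    Matrix.mulVec_single_one, Matrix.col_apply] at this
  rw [Matrix.vecMulVec_apply, ← this, mul_comm]

variable {n : ℕ} {G : Subgroup (GL (Fin n) ℂ)}

/-- For a reflection `g`, the difference quotient `(f ∘ g - f) / l` by an equation `l` of the
reflecting hyperplane. -/
theorem exists_demazure {g : GL (Fin n) ℂ} (hg : g ∈ G) (hr : IsReflection g) :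
    ∃ (l : MvPolynomial (Fin n) ℂ) (D : MvPolynomial (Fin n) ℂ →ₗ[invariants G]
        MvPolynomial (Fin n) ℂ),
      (∀ f, linSubst (g : Matrix (Fin n) (Fin n) ℂ) f = f + l * D f) ∧
      (∀ f, f.totalDegree = 0 → D f = 0) ∧
      ∀ f d, f.totalDegree ≤ d + 1 → (D f).totalDegree ≤ d := by
  set A : Matrix (Fin n) (Fin n) ℂ := (g : Matrix (Fin n) (Fin n) ℂ) with hA
  obtain ⟨u, w, huw⟩ := exists_eq_vecMulVec_of_rank_eq_one (show (A - 1).rank = 1 from hr)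
  have hw : w ≠ 0 := by
    rintro rfl
    have : (A - 1).rank = 1 := hr
    rw [huw] at this
    simp at this
  let l : MvPolynomial (Fin n) ℂ := ∑ j, MvPolynomial.C (w j) * MvPolynomial.X j
  have hl : l ≠ 0 := by
    obtain ⟨j, hj⟩ := Function.ne_iff.mp hw
    intro h
    have := congrArg (MvPolynomial.eval (Pi.single j (1 : ℂ))) h
    simp [l, Pi.single_apply] at this
    exact hj this
  have hl1 : 1 ≤ l.totalDegree := by
    rw [Nat.one_le_iff_ne_zero]
    intro h
    rw [MvPolynomial.totalDegree_eq_zero_iff_eq_C] at h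
    have h2 : l.coeff 0 = 0 := by simp [l, MvPolynomial.coeff_sum]
    rw [h2, map_zero] at h
    exact hl h
  -- Since `A v = v + (w · v) u`, the map `A` is the identity modulo `l`; it suffices to check this
  -- on the variables, where the difference is `u i` times `l`.
  have hdvd : ∀ f, l ∣ linSubst A f - f := by
    intro f
    rw [← Ideal.mem_span_singleton, ← Ideal.Quotient.eq]
    have : ((Ideal.Quotient.mkₐ ℂ (Ideal.span {l})).comp (linSubst A)) =
        Ideal.Quotient.mkₐ ℂ (Ideal.span {l}) := by
      refine MvPolynomial.algHom_ext fun i => ?_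
      refine Ideal.Quotient.eq.mpr (Ideal.mem_span_singleton.mpr ⟨MvPolynomial.C (u i), ?_⟩)
      have h1 : ∀ j, A i j = (1 : Matrix (Fin n) (Fin n) ℂ) i j + u i * w j := fun j => by
        have := congrFun (congrFun huw i) j
        simp [Matrix.vecMulVec_apply] at this
        rw [← this]; ring
      refine MvPolynomial.funext fun v => ?_
      change MvPolynomial.eval v (linSubst A (MvPolynomial.X i) - MvPolynomial.X i) = _
      simp only [linSubst, MvPolynomial.aeval_X, h1, map_sub, map_sum, map_mul,
        map_add, MvPolynomial.eval_C, MvPolynomial.eval_X, l, add_mul, Finset.sum_add_distrib,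
        Matrix.one_apply, ite_mul, one_mul, zero_mul, Finset.sum_ite_eq,
        Finset.mem_univ, if_true]
      rw [add_sub_cancel_left, Finset.sum_mul]
      exact Finset.sum_congr rfl fun j _ => by ring
    exact DFunLike.congr_fun this f
  choose D hD using hdvd
  have hD' : ∀ f, linSubst A f = f + l * D f := fun f => by rw [← hD]; ring
  -- Substitution does not raise the degree and `l` has degree at least one, so division by `l`
  -- lowers it. The zero alternative is separate because zero has `totalDegree` equal to `0`.
  have key : ∀ f d, f.totalDegree ≤ d → D f = 0 ∨ (D f).totalDegree + 1 ≤ d := by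
    intro f d hf
    by_cases h0 : D f = 0
    · exact Or.inl h0
    right
    have h1 := MvPolynomial.totalDegree_mul_of_isDomain hl h0
    have h2 : (l * D f).totalDegree ≤ d := by
      rw [← hD, ]
      exact (MvPolynomial.totalDegree_sub _ _).trans
        (max_le ((totalDegree_linSubst_le _ _).trans hf) hf)
    omega
  refine ⟨l, { toFun := D, map_add' := fun x y => ?_, map_smul' := fun r x => ?_ }, hD', ?_, ?_⟩
  · refine mul_left_cancel₀ hl ?_
    rw [← hD, mul_add, ← hD, ← hD, map_add]; ring
  · refine mul_left_cancel₀ hl ?_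
    have : linSubst A (r : MvPolynomial (Fin n) ℂ) = r := r.2 g hg
    rw [← hD, RingHom.id_apply, Subalgebra.smul_def, Subalgebra.smul_def, smul_eq_mul, smul_eq_mul,
      map_mul, this, mul_left_comm, ← hD]
    ring
  · intro f hf
    rcases key f 0 hf.le with h | h
    · exact h
    · omega
  · intro f d hf
    rcases key f (d + 1) hf with h | h
    · simp [h]
    · exact Nat.le_of_succ_le_succ h

/-- Elements of `ℂ[x] ⊗ N` of polynomial degree at most `d`. -/
def degreeFiltration (G : Subgroup (GL (Fin n) ℂ)) (N : Type*) [AddCommGroup N]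
    [Module (invariants G) N] (d : ℕ) : AddSubgroup (MvPolynomial (Fin n) ℂ ⊗[invariants G] N) :=
  AddSubgroup.closure {x | ∃ f a, f.totalDegree ≤ d ∧ f ⊗ₜ a = x}

theorem exists_mem_degreeFiltration (N : Type*) [AddCommGroup N]
    [Module (invariants G) N] (x : MvPolynomial (Fin n) ℂ ⊗[invariants G] N) :
    ∃ d, x ∈ degreeFiltration G N d := by
  induction x with
  | zero => exact ⟨0, zero_mem _⟩
  | tmul f a => exact ⟨f.totalDegree, AddSubgroup.subset_closure ⟨f, a, le_rfl, rfl⟩⟩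
  | add x y hx hy =>
    obtain ⟨d, hd⟩ := hx
    obtain ⟨e, he⟩ := hy
    refine ⟨max d e, add_mem ?_ ?_⟩
    · refine AddSubgroup.closure_mono ?_ hd
      rintro _ ⟨f, a, h, rfl⟩
      exact ⟨f, a, h.trans (le_max_left _ _), rfl⟩
    · refine AddSubgroup.closure_mono ?_ he
      rintro _ ⟨f, a, h, rfl⟩
      exact ⟨f, a, h.trans (le_max_right _ _), rfl⟩

theorem rTensor_groupSubst_eq {N : Type*} [AddCommGroup N] [Module (invariants G) N] {g : G}
    {l : MvPolynomial (Fin n) ℂ} {D : MvPolynomial (Fin n) ℂ →ₗ[invariants G] MvPolynomial (Fin n) ℂ}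
    (h : ∀ f, linSubst ((g : GL (Fin n) ℂ) : Matrix (Fin n) (Fin n) ℂ) f = f + l * D f)
    (x : MvPolynomial (Fin n) ℂ ⊗[invariants G] N) :
    (groupSubst G g).toLinearMap.rTensor N x =
      x + (LinearMap.mulLeft (invariants G) l).rTensor N (D.rTensor N x) := by
  have : (groupSubst G g).toLinearMap = LinearMap.id + LinearMap.mulLeft (invariants G) l ∘ₗ D :=
    LinearMap.ext h
  rw [this, LinearMap.rTensor_add, LinearMap.add_apply, LinearMap.rTensor_id_apply,
    LinearMap.rTensor_comp_apply]

theorem rTensor_eq_zero_of_mem_degreeFiltration {N : Type*} [AddCommGroup N]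
    [Module (invariants G) N]
    {D : MvPolynomial (Fin n) ℂ →ₗ[invariants G] MvPolynomial (Fin n) ℂ}
    (h : ∀ f, f.totalDegree = 0 → D f = 0) {x : MvPolynomial (Fin n) ℂ ⊗[invariants G] N}
    (hx : x ∈ degreeFiltration G N 0) : D.rTensor N x = 0 := by
  induction hx using AddSubgroup.closure_induction with
  | mem y hy =>
    obtain ⟨f, a, hf, rfl⟩ := hy
    rw [LinearMap.rTensor_tmul, h f (Nat.le_zero.mp hf), zero_tmul]
  | zero => exact map_zero _
  | add y z _ _ hy hz => rw [map_add, hy, hz, add_zero]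
  | neg y _ hy => rw [map_neg, hy, neg_zero]

theorem rTensor_mem_degreeFiltration {N : Type*} [AddCommGroup N]
    [Module (invariants G) N] {d : ℕ}
    {D : MvPolynomial (Fin n) ℂ →ₗ[invariants G] MvPolynomial (Fin n) ℂ}
    (h : ∀ f d, f.totalDegree ≤ d + 1 → (D f).totalDegree ≤ d)
    {x : MvPolynomial (Fin n) ℂ ⊗[invariants G] N}
    (hx : x ∈ degreeFiltration G N (d + 1)) : D.rTensor N x ∈ degreeFiltration G N d := by
  induction hx using AddSubgroup.closure_induction with
  | mem y hy =>
    obtain ⟨f, a, hf, rfl⟩ := hy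
    exact AddSubgroup.subset_closure ⟨D f, a, h f d hf, rfl⟩
  | zero => exact (map_zero (D.rTensor N)).symm ▸ zero_mem _
  | add y z _ _ hy hz => exact (map_add (D.rTensor N) y z).symm ▸ add_mem hy hz
  | neg y _ hy => exact (map_neg (D.rTensor N) y).symm ▸ neg_mem hy

/-- Reflections generate `G`, so `x` is fixed by all of `G` and equals its average. It therefore
factors through its Reynolds image in `R ⊗ N`, where `j` stays injective because `R` is flat over
itself. -/
theorem eq_zero_of_forall_reflection [Finite G] {N N' : Type*} [AddCommGroup N]
    [Module (invariants G) N] [AddCommGroup N'] [Module (invariants G) N']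
    (hG : Subgroup.closure {g : GL (Fin n) ℂ | g ∈ G ∧ IsReflection g} = G)
    (j : N →ₗ[invariants G] N') (hj : Function.Injective j)
    (x : MvPolynomial (Fin n) ℂ ⊗[invariants G] N) (hx : j.lTensor (MvPolynomial (Fin n) ℂ) x = 0)
    (h : ∀ g : G, IsReflection (g : GL (Fin n) ℂ) →
      (groupSubst G g).toLinearMap.rTensor N x = x) : x = 0 := by
  let _ := Fintype.ofFinite G
  have hinv : ∀ g : G, (groupSubst G g).toLinearMap.rTensor N x = x := by
    rintro ⟨g, hg⟩
    have hg' := hg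
    rw [← hG] at hg'
    induction hg' using Subgroup.closure_induction with
    | mem y hy => exact h ⟨y, hg⟩ hy.2
    | one => 
      have : (⟨1, hg⟩ : G) = 1 := rfl
      rw [this, groupSubst_one]
      exact LinearMap.rTensor_id_apply ..
    | mul y z hy hz ihy ihz =>
      rw [hG] at hy hz
      have e : (⟨y * z, hg⟩ : G) = ⟨y, hy⟩ * ⟨z, hz⟩ := rfl
      rw [e, groupSubst_mul, AlgHom.comp_toLinearMap, LinearMap.rTensor_comp_apply, ihy hy, ihz hz]
    | inv y hy ihy =>
      rw [hG] at hy
      have e : (groupSubst G (⟨y⁻¹, hg⟩)).toLinearMap ∘ₗ (groupSubst G ⟨y, hy⟩).toLinearMap =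
          LinearMap.id := by
        rw [← AlgHom.comp_toLinearMap, ← groupSubst_mul]
        have : (⟨y, hy⟩ * ⟨y⁻¹, hg⟩ : G) = 1 := Subtype.ext (mul_inv_cancel y)
        rw [this, groupSubst_one]; rfl
      conv_lhs => rw [← ihy hy]
      rw [← LinearMap.rTensor_comp_apply, e, LinearMap.rTensor_id_apply]
  let ι := Algebra.linearMap (invariants G) (MvPolynomial (Fin n) ℂ)
  have hav : (ι ∘ₗ reynolds G).rTensor N x = x := by
    rw [linearMap_comp_reynolds, average_eq, LinearMap.rTensor_smul, LinearMap.smul_apply,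
      ← LinearMap.coe_rTensorHom, map_sum, LinearMap.sum_apply]
    simp only [LinearMap.coe_rTensorHom, hinv, Finset.sum_const, Finset.card_univ,
      ← Nat.card_eq_fintype_card]
    exact invCard_smul_card_smul G x
  have h0 : (reynolds G).rTensor N x = 0 := by
    have h1 : j.lTensor (invariants G) ((reynolds G).rTensor N x) = 0 := by
      rw [← LinearMap.comp_apply, LinearMap.lTensor_comp_rTensor, ← LinearMap.rTensor_comp_lTensor,
        LinearMap.comp_apply, hx, map_zero]
    exact Module.Flat.lTensor_preserves_injective_linearMap j hj (h1.trans (map_zero _).symm)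
  rw [← hav, LinearMap.rTensor_comp_apply, h0, map_zero]

/-- The polynomial ring is flat over the invariants of a complex reflection group. -/
theorem flat_of_isComplexReflectionGroup (hG : IsComplexReflectionGroup G) :
    Module.Flat (invariants G) (MvPolynomial (Fin n) ℂ) := by
  have := hG.1
  rw [Module.Flat.iff_lTensor_preserves_injective_linearMap]
  intro N N' _ _ _ _ j hj
  rw [injective_iff_map_eq_zero]
  -- Tensoring with `D` commutes with tensoring with `j`, so `D x` is again in the kernel, one
  -- degree lower. By induction it vanishes, and then the reflection fixes `x`.
  have main : ∀ d, ∀ x ∈ degreeFiltration G N d,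
      j.lTensor (MvPolynomial (Fin n) ℂ) x = 0 → x = 0 := by
    intro d
    induction d with
    | zero =>
      intro x hx h
      refine eq_zero_of_forall_reflection hG.2 j hj x h fun g hg => ?_
      obtain ⟨l, D, h1, h2, -⟩ := exists_demazure g.2 hg
      rw [rTensor_groupSubst_eq h1, rTensor_eq_zero_of_mem_degreeFiltration h2 hx, map_zero,
        add_zero]
    | succ d ih =>
      intro x hx h
      refine eq_zero_of_forall_reflection hG.2 j hj x h fun g hg => ?_
      obtain ⟨l, D, h1, -, h3⟩ := exists_demazure g.2 hg
      rw [rTensor_groupSubst_eq h1, ih _ (rTensor_mem_degreeFiltration h3 hx) ?_, map_zero,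
        add_zero]
      rw [← LinearMap.comp_apply, LinearMap.lTensor_comp_rTensor, ← LinearMap.rTensor_comp_lTensor,
        LinearMap.comp_apply, h, map_zero]
  intro x hx
  obtain ⟨d, hd⟩ := exists_mem_degreeFiltration N x
  exact main d x hd hx

end Demazure

/-! ### Characters determine representations in characteristic zero -/

section Characters

variable {k H : Type*} [Field k] [CharZero k] [Group H] [Finite H]

/-- The character of a module over a group algebra. -/
def moduleCharacter (k : Type*) {H : Type*} [Field k] [Group H] (M : Type*) [AddCommGroup M]
    [Module k M] [Module (MonoidAlgebra k H) M]
    [IsScalarTower k (MonoidAlgebra k H) M] (g : H) : k :=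
  LinearMap.trace k M (Algebra.lsmul k k M (MonoidAlgebra.single g (1 : k)))

variable {M N : Type*} [AddCommGroup M] [Module k M] [Module (MonoidAlgebra k H) M]
  [IsScalarTower k (MonoidAlgebra k H) M]
  [AddCommGroup N] [Module k N] [Module (MonoidAlgebra k H) N]
  [IsScalarTower k (MonoidAlgebra k H) N]

omit [CharZero k] [Finite H] in
theorem moduleCharacter_congr (e : M ≃ₗ[MonoidAlgebra k H] N) (g : H) :
    moduleCharacter k M g = moduleCharacter k N g := by
  rw [moduleCharacter, moduleCharacter, ← LinearMap.trace_conj' _ (e.restrictScalars k)]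
  congr 1
  ext x
  simp [LinearEquiv.conj_apply]

omit [CharZero k] [Finite H] in
theorem moduleCharacter_prod [FiniteDimensional k M] [FiniteDimensional k N] (g : H) :
    moduleCharacter k (M × N) g = moduleCharacter k M g + moduleCharacter k N g := by
  rw [moduleCharacter, moduleCharacter, moduleCharacter, ← LinearMap.trace_prodMap']
  rfl

omit [CharZero k] [Finite H] in
theorem moduleCharacter_one [FiniteDimensional k M] :
    moduleCharacter k (H := H) M 1 = Module.finrank k M := by
  rw [moduleCharacter, ← MonoidAlgebra.one_def, map_one, LinearMap.trace_one]

/-- If the characters of two nonzero representations agree, there is a nonzero map between them. -/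
theorem exists_linearMap_ne_zero [FiniteDimensional k M] [FiniteDimensional k N] [Nontrivial M]
    (h : ∀ g : H, moduleCharacter k M g = moduleCharacter k N g) :
    ∃ f : M →ₗ[MonoidAlgebra k H] N, f ≠ 0 := by
  have := Fintype.ofFinite H
  have : Invertible (Nat.card H : k) := invertibleOfNonzero (by exact_mod_cast Nat.card_pos.ne')
  let ρ := Representation.ofModule' (k := k) (G := H) M
  let σ := Representation.ofModule' (k := k) (G := H) N
  have h1 : ∀ g, ρ.character g = σ.character g := h
  -- The dimension of a space of intertwiners depends only on the characters, so it equals that of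
  -- the endomorphisms of `M`, among which is the nonzero identity.
  have h2 : (Module.finrank k (ρ.IntertwiningMap σ) : k) =
      Module.finrank k (ρ.IntertwiningMap ρ) := by
    rw [← Representation.card_inv_mul_sum_char_mul_char_eq_finrank,
      ← Representation.card_inv_mul_sum_char_mul_char_eq_finrank]
    simp only [h1]
  have h3 : Module.finrank k (ρ.IntertwiningMap σ) ≠ 0 := by
    rw [Nat.cast_injective h2]
    have : Nontrivial (ρ.IntertwiningMap ρ) := by
      obtain ⟨m, hm⟩ := exists_ne (0 : M)
      exact ⟨⟨.id ρ, 0, fun h => hm (DFunLike.congr_fun h m)⟩⟩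
    exact Module.finrank_pos.ne'
  have : Nontrivial (ρ.IntertwiningMap σ) :=
    Module.nontrivial_of_finrank_pos (Nat.pos_of_ne_zero h3)
  obtain ⟨f, hf⟩ := exists_ne (0 : ρ.IntertwiningMap σ)
  refine ⟨MonoidAlgebra.equivariantOfLinearOfComm f.toLinearMap
    (fun g v => Representation.IntertwiningMap.isIntertwining _ _ f g v), fun h => hf ?_⟩
  exact Representation.IntertwiningMap.ext (LinearMap.ext fun v => DFunLike.congr_fun h v)

/-- Representations of a finite group in characteristic zero are determined by their characters. -/
theorem nonempty_linearEquiv_of_moduleCharacter_eq [FiniteDimensional k M] [FiniteDimensional k N]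
    (h : ∀ g : H, moduleCharacter k M g = moduleCharacter k N g) :
    Nonempty (M ≃ₗ[MonoidAlgebra k H] N) := by
  have : NeZero (Nat.card H : k) := ⟨by exact_mod_cast Nat.card_pos.ne'⟩
  induction hd : Module.finrank k M using Nat.strong_induction_on generalizing M N with
  | _ d ih =>
    have h1 : Module.finrank k M = Module.finrank k N := by
      have := h 1
      rw [moduleCharacter_one, moduleCharacter_one] at this
      exact_mod_cast this
    rcases subsingleton_or_nontrivial M with hM | hM
    · have : Subsingleton N := by
        rw [← Module.finrank_zero_iff (R := k), ← h1, Module.finrank_zero_of_subsingleton]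
      exact ⟨0⟩
    · obtain ⟨f, hf⟩ := exists_linearMap_ne_zero h
      let K := LinearMap.ker f
      let L := LinearMap.range f
      -- Maschke's theorem splits off the common summand `K' ≃ L`. Cancelling its character leaves
      -- `K` and `L'`, of smaller dimension, for the induction.
      obtain ⟨K', hK⟩ := MonoidAlgebra.Submodule.exists_isCompl K
      obtain ⟨L', hL⟩ := MonoidAlgebra.Submodule.exists_isCompl L
      have e : K' ≃ₗ[MonoidAlgebra k H] L :=
        (Submodule.quotientEquivOfIsCompl K K' hK).symm.trans f.quotKerEquivRange
      have fdM (P : Submodule (MonoidAlgebra k H) M) : FiniteDimensional k P :=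
        inferInstanceAs (FiniteDimensional k (P.restrictScalars k))
      have fdN (P : Submodule (MonoidAlgebra k H) N) : FiniteDimensional k P :=
        inferInstanceAs (FiniteDimensional k (P.restrictScalars k))
      have eM := Submodule.prodEquivOfIsCompl K K' hK
      have eN := Submodule.prodEquivOfIsCompl L' L hL.symm
      have hchar (g : H) : moduleCharacter k K g = moduleCharacter k L' g := by
        have := h g
        rw [← moduleCharacter_congr eM, ← moduleCharacter_congr eN, moduleCharacter_prod,
          moduleCharacter_prod, moduleCharacter_congr e] at this
        exact add_right_cancel this
      have hlt : Module.finrank k K < d := by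
        rw [← hd]
        refine Submodule.finrank_lt (s := K.restrictScalars k) fun htop => hf ?_
        exact LinearMap.ext fun x => (show x ∈ K.restrictScalars k from htop ▸ Submodule.mem_top)
      obtain ⟨e'⟩ := ih _ hlt hchar rfl
      exact ⟨eM.symm.trans ((e'.prodCongr e).trans eN)⟩

end Characters

/-! ### Traces on projective modules, and recognition of the regular representation -/

section ProjectiveTrace

/-- The trace of endomorphisms of a finitely generated projective module, characterized by its
compatibility with the trace over field-valued points. -/
theorem exists_projectiveTrace (R P : Type) [CommRing R] [AddCommGroup P] [Module R P]
    [Module.Finite R P] [Module.Projective R P] :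
    ∃ t : (P →ₗ[R] P) →ₗ[R] R, (∀ f g, t (f ∘ₗ g) = t (g ∘ₗ f)) ∧
      ∀ (K : Type) [Field K] [Algebra R K] (f : P →ₗ[R] P),
        LinearMap.trace K (K ⊗[R] P) (f.baseChange K) = algebraMap R K (t f) := by
  -- `P` is a direct summand of a free module via `p ∘ i = id`; the trace of `f` is defined as the
  -- matrix trace of `i ∘ f ∘ p`.
  obtain ⟨m, p, hp⟩ := Module.Finite.exists_fin' R P
  obtain ⟨i, hi⟩ := Module.projective_lifting_property p LinearMap.id hp
  refine ⟨LinearMap.trace R (Fin m → R) ∘ₗ LinearMap.llcomp R _ _ _ i ∘ₗ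
    LinearMap.lcomp R _ p, fun f g => ?_, fun K _ _ f => ?_⟩
  · change LinearMap.trace R _ (i ∘ₗ (f ∘ₗ g) ∘ₗ p) = LinearMap.trace R _ (i ∘ₗ (g ∘ₗ f) ∘ₗ p)
    have h (f g : P →ₗ[R] P) : i ∘ₗ (f ∘ₗ g) ∘ₗ p = (i ∘ₗ f ∘ₗ p) ∘ₗ (i ∘ₗ g ∘ₗ p) := by
      ext x
      have := DFunLike.congr_fun hi (g (p (Pi.single x 1)))
      simp at this
      simp [this]
    rw [h, h]
    exact LinearMap.trace_mul_comm R _ _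
  · change _ = algebraMap R K (LinearMap.trace R _ (i ∘ₗ f ∘ₗ p))
    rw [← LinearMap.trace_baseChange, LinearMap.baseChange_comp, LinearMap.trace_comp_comm',
      ← LinearMap.baseChange_comp, LinearMap.comp_assoc, hi, LinearMap.comp_id]

/-- By cyclicity, the trace of the projector `i ∘ p` is that of `p ∘ i`, the identity of a line. -/
theorem trace_baseChange_comp_eq_one {R P : Type} [CommRing R] [AddCommGroup P] [Module R P]
    [Module.Finite R P] {i : R →ₗ[R] P} {p : P →ₗ[R] R} (h : p ∘ₗ i = LinearMap.id)
    (K : Type) [Field K] [Algebra R K] :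
    LinearMap.trace K (K ⊗[R] P) ((i ∘ₗ p).baseChange K) = 1 := by
  have := (algebraMap R K).domain_nontrivial
  rw [LinearMap.baseChange_comp, LinearMap.trace_comp_comm',
    ← LinearMap.baseChange_comp, h, LinearMap.baseChange_id,
    LinearMap.trace_id, Module.finrank_baseChange, Module.finrank_self, Nat.cast_one]

/-- If averaging over a group projects `P` onto a free module of rank one and the nontrivial
elements have trace zero on a fibre, then the dimension of the fibre is the order of the group. -/
theorem finrank_baseChange_eq_card {R P H : Type} [CommRing R] [AddCommGroup P] [Module R P]
    [Module.Finite R P] [Group H] [Fintype H] {i : R →ₗ[R] P} {p : P →ₗ[R] R}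
    (h : p ∘ₗ i = LinearMap.id) (σ : H → P →ₗ[R] P) (hσ : σ 1 = LinearMap.id)
    (hav : (Nat.card H : R) • (i ∘ₗ p) = ∑ g, σ g)
    (K : Type) [Field K] [CharZero K] [Algebra R K]
    (ht : ∀ g, g ≠ 1 → LinearMap.trace K (K ⊗[R] P) ((σ g).baseChange K) = 0) :
    Module.finrank K (K ⊗[R] P) = Nat.card H := by
  have h1 : (Nat.card H : K) • (i ∘ₗ p).baseChange K = ∑ g, (σ g).baseChange K := by
    have := congrArg (LinearMap.baseChangeHom R K P P) hav
    rw [map_sum, Nat.cast_smul_eq_nsmul, map_nsmul] at this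
    rw [Nat.cast_smul_eq_nsmul]
    exact this
  -- The left side has trace the order of the group, while on the right only the identity element
  -- contributes, with the dimension of the fibre.
  have h2 := congrArg (LinearMap.trace K (K ⊗[R] P)) h1
  rw [map_smul, map_sum, trace_baseChange_comp_eq_one h, Finset.sum_eq_single 1
    (fun g _ hg => ht g hg) (fun hg => absurd (Finset.mem_univ _) hg), hσ,
    LinearMap.baseChange_id, LinearMap.trace_id, smul_eq_mul, mul_one] at h2
  exact_mod_cast h2.symm

/-- Left translation by `g` permutes the standard basis without fixed points, so its matrix has zero
diagonal. -/
theorem moduleCharacter_monoidAlgebra {k H : Type*} [Field k] [Group H] [Finite H] {g : H} (hg : g ≠ 1) :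
    moduleCharacter k (MonoidAlgebra k H) g = 0 := by
  classical
  let _ := Fintype.ofFinite H
  rw [moduleCharacter, LinearMap.trace_eq_matrix_trace k (MonoidAlgebra.basis H k), Matrix.trace]
  refine Finset.sum_eq_zero fun h _ => ?_
  rw [Matrix.diag_apply, LinearMap.toMatrix_apply, MonoidAlgebra.basis_apply]
  change ((MonoidAlgebra.basis H k).repr
    (MonoidAlgebra.single g (1 : k) * MonoidAlgebra.single h (1 : k))) h = 0
  rw [MonoidAlgebra.single_mul_single]
  refine Finsupp.single_eq_of_ne fun h' => hg ?_
  simpa using h'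

/-- A representation of dimension the order of the group on which the nontrivial elements have
trace zero is the regular representation. -/
theorem exists_equiv_monoidAlgebra {k H V : Type*} [Field k] [CharZero k] [Group H] [Finite H]
    [AddCommGroup V] [Module k V] [FiniteDimensional k V] (ρ : Representation k H V)
    (hV : Module.finrank k V = Nat.card H)
    (hρ : ∀ g, g ≠ 1 → LinearMap.trace k V (ρ g) = 0) :
    ∃ φ : V ≃ₗ[k] MonoidAlgebra k H, ∀ g x, φ (ρ g x) = MonoidAlgebra.single g 1 * φ x := by
  let _ : Module (MonoidAlgebra k H) V := Module.compHom V ρ.asAlgebraHom.toRingHom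
  have hs (a : MonoidAlgebra k H) (v : V) : a • v = ρ.asAlgebraHom a v := rfl
  have : IsScalarTower k (MonoidAlgebra k H) V := ⟨fun c a v => by
    rw [hs, hs, map_smul, LinearMap.smul_apply]⟩
  have hsingle (g : H) (v : V) : MonoidAlgebra.single g (1 : k) • v = ρ g v := by
    rw [hs, Representation.asAlgebraHom_single_one]
  have : FiniteDimensional k (MonoidAlgebra k H) := Module.Finite.of_basis (MonoidAlgebra.basis H k)
  have hchar (g : H) : moduleCharacter k V g = moduleCharacter k (MonoidAlgebra k H) g := by
    rcases eq_or_ne g 1 with rfl | hg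
    · rw [moduleCharacter_one, moduleCharacter_one, hV,
        Module.finrank_eq_nat_card_basis (MonoidAlgebra.basis H k)]
    · rw [moduleCharacter_monoidAlgebra hg, ← hρ g hg, moduleCharacter]
      congr 1
      exact LinearMap.ext fun v => hsingle g v
  obtain ⟨e⟩ := nonempty_linearEquiv_of_moduleCharacter_eq hchar
  exact ⟨e.restrictScalars k, fun g x => by
    rw [← hsingle]; exact map_smul e (MonoidAlgebra.single g (1 : k)) x⟩

end ProjectiveTrace

/-! ### Fibres of the quotient map as regular representations -/

section Fibres

variable {n : ℕ} {G : Subgroup (GL (Fin n) ℂ)}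

/-- Choose `z` moved by `g` and, by integrality, a multiple `d = c * (g z - z)` that is a nonzero
invariant. Then `d • g` is the commutator of `c * g` with multiplication by `z`, so `d` times the
trace is zero in a domain. -/
theorem projectiveTrace_groupSubst_eq_zero [Finite G]
    {t : (MvPolynomial (Fin n) ℂ →ₗ[invariants G] MvPolynomial (Fin n) ℂ) →ₗ[invariants G]
      invariants G} (ht : ∀ f g, t (f ∘ₗ g) = t (g ∘ₗ f)) {g : G} (hg : g ≠ 1) :
    t (groupSubst G g).toLinearMap = 0 := by
  obtain ⟨z, hz⟩ : ∃ z, groupSubst G g z ≠ z := by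
    by_contra! h
    exact hg ((groupSubst_eq_id_iff G g).mp (AlgHom.ext h))
  obtain ⟨d, hd, c, hc⟩ := (Algebra.IsIntegral.isIntegral (R := invariants G)
    (groupSubst G g z - z)).isAlgebraic.exists_nonzero_dvd
      (mem_nonZeroDivisors_of_ne_zero (sub_ne_zero.mpr hz))
  have h : d • (groupSubst G g).toLinearMap =
      (LinearMap.mulLeft (invariants G) c ∘ₗ (groupSubst G g).toLinearMap) ∘ₗ
        LinearMap.mulLeft (invariants G) z -
      LinearMap.mulLeft (invariants G) z ∘ₗ
        LinearMap.mulLeft (invariants G) c ∘ₗ (groupSubst G g).toLinearMap := by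
    refine LinearMap.ext fun x => ?_
    simp only [LinearMap.smul_apply, AlgHom.toLinearMap_apply, LinearMap.sub_apply,
      LinearMap.comp_apply, LinearMap.mulLeft_apply, map_mul]
    rw [Algebra.smul_def, hc]
    ring
  have h2 : d * t (groupSubst G g).toLinearMap = 0 := by
    rw [← smul_eq_mul, ← map_smul, h, map_sub, ht, sub_self]
  exact (mul_eq_zero.mp h2).resolve_left hd

theorem charZero_of_algebra_invariants (K : Type) [Field K] [Algebra (invariants G) K] :
    CharZero K :=
  charZero_of_injective_ringHom
    ((algebraMap (invariants G) K).comp (algebraMap ℂ (invariants G))).injective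

theorem trace_groupSubst_eq_zero (hG : IsComplexReflectionGroup G) (K : Type) [Field K]
    [Algebra (invariants G) K] {g : G} (hg : g ≠ 1) :
    LinearMap.trace K (K ⊗[invariants G] MvPolynomial (Fin n) ℂ)
      ((groupSubst G g).toLinearMap.baseChange K) = 0 := by
  have := hG.1
  have := flat_of_isComplexReflectionGroup hG
  have : Module.Projective (invariants G) (MvPolynomial (Fin n) ℂ) :=
    have := Module.finitePresentation_of_finite (invariants G) (MvPolynomial (Fin n) ℂ)
    Module.Flat.projective_of_finitePresentation
  obtain ⟨t, h1, h2⟩ := exists_projectiveTrace (invariants G) (MvPolynomial (Fin n) ℂ)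
  rw [h2, projectiveTrace_groupSubst_eq_zero h1 hg, map_zero]

theorem finrank_fibre (hG : IsComplexReflectionGroup G) (K : Type) [Field K]
    [Algebra (invariants G) K] :
    Module.finrank K (K ⊗[invariants G] MvPolynomial (Fin n) ℂ) = Nat.card G := by
  have := hG.1
  let _ := Fintype.ofFinite G
  have := charZero_of_algebra_invariants (G := G) K
  refine finrank_baseChange_eq_card (reynolds_comp_linearMap G)
    (fun g : G => (groupSubst G g).toLinearMap) ?_ ?_ K fun g hg => trace_groupSubst_eq_zero hG K hg
  · rw [groupSubst_one, AlgHom.toLinearMap_id]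
  · rw [linearMap_comp_reynolds, average_eq, smul_comm, Nat.cast_smul_eq_nsmul]
    exact invCard_smul_card_smul G _

/-- The fibres of the quotient map carry the regular representation. -/
theorem exists_fibre_equiv_monoidAlgebra (hG : IsComplexReflectionGroup G) (K : Type) [Field K]
    [Algebra (invariants G) K] :
    ∃ φ : (K ⊗[invariants G] MvPolynomial (Fin n) ℂ) ≃ₗ[K] MonoidAlgebra K G,
      ∀ (g : G) x, φ ((groupSubst G g⁻¹).toLinearMap.baseChange K x) =
        MonoidAlgebra.single g 1 * φ x := by
  have := hG.1
  have := charZero_of_algebra_invariants (G := G) K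
  let ρ : Representation K G (K ⊗[invariants G] MvPolynomial (Fin n) ℂ) :=
    { toFun := fun g => (groupSubst G g⁻¹).toLinearMap.baseChange K
      map_one' := by
        rw [inv_one, groupSubst_one, AlgHom.toLinearMap_id, LinearMap.baseChange_id]; rfl
      map_mul' := fun g h => by
        rw [mul_inv_rev, groupSubst_mul, AlgHom.comp_toLinearMap, LinearMap.baseChange_comp]; rfl }
  exact exists_equiv_monoidAlgebra ρ (finrank_fibre hG K) fun g hg =>
    trace_groupSubst_eq_zero hG K (inv_ne_one.mpr hg)

end Fibres

/-! ### Detecting vanishing and injectivity on fibres -/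

section Nakayama

/-- A finite module whose fibres over fields vanish at all primes is zero. -/
theorem subsingleton_of_forall_fibre {A N : Type} [CommRing A] [AddCommGroup N] [Module A N]
    [Module.Finite A N]
    (h : ∀ p : PrimeSpectrum A, ∃ (K : Type) (_ : Field K) (_ : Algebra A K),
      RingHom.ker (algebraMap A K) = p.asIdeal ∧ Subsingleton (K ⊗[A] N)) :
    Subsingleton N := by
  rw [← Module.support_eq_empty_iff (R := A), Set.eq_empty_iff_forall_notMem]
  intro p hp
  obtain ⟨K, _, _, hK, hN⟩ := h p
  rw [Module.mem_support_iff_nontrivial_residueField_tensorProduct] at hp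
  have hunit : p.asIdeal.primeCompl ≤ Submonoid.comap (algebraMap A K) (IsUnit.submonoid K) :=
    fun x hx => IsUnit.mk0 _ fun h0 => hx (hK.le h0)
  -- `K` has kernel `p`, so it is an extension of the residue field, hence faithfully flat over it;
  -- vanishing over `K` descends.
  let f : p.asIdeal.ResidueField →+* K :=
    Ideal.ResidueField.lift p.asIdeal (algebraMap A K) hK.ge hunit
  let _ : Algebra p.asIdeal.ResidueField K := f.toAlgebra
  have : IsScalarTower A p.asIdeal.ResidueField K := IsScalarTower.of_algebraMap_eq' (by
    ext x
    exact (Ideal.ResidueField.lift_algebraMap p.asIdeal (algebraMap A K) hK.ge hunit x).symm)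
  have e := TensorProduct.AlgebraTensorModule.cancelBaseChange A p.asIdeal.ResidueField K K N
  have := Module.FaithfullyFlat.lTensor_nontrivial p.asIdeal.ResidueField K
    (p.asIdeal.ResidueField ⊗[A] N)
  exact not_subsingleton (K ⊗[p.asIdeal.ResidueField] (p.asIdeal.ResidueField ⊗[A] N))
    e.subsingleton

/-- A surjection from a finite module to a finite projective module of the same fibre dimensions
is injective. -/
theorem injective_of_surjective_of_finrank_eq {A P B : Type} [CommRing A] [IsNoetherianRing A]
    [AddCommGroup P] [Module A P] [Module.Finite A P] [AddCommGroup B] [Module A B]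
    [Module.Finite A B] [Module.Projective A B] (f : P →ₗ[A] B) (hf : Function.Surjective f)
    (h : ∀ p : PrimeSpectrum A, ∃ (K : Type) (_ : Field K) (_ : Algebra A K),
      RingHom.ker (algebraMap A K) = p.asIdeal ∧
        Module.finrank K (K ⊗[A] P) = Module.finrank K (K ⊗[A] B)) :
    Function.Injective f := by
  obtain ⟨s, hs⟩ := Module.projective_lifting_property f LinearMap.id hf
  rw [← LinearMap.ker_eq_bot, ← Submodule.subsingleton_iff_eq_bot]
  refine subsingleton_of_forall_fibre (A := A) fun p => ?_
  obtain ⟨K, _, _, hK, hd⟩ := h p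
  refine ⟨K, _, _, hK, ?_⟩
  have hinj : Function.Injective (f.baseChange K) :=
    (LinearMap.injective_iff_surjective_of_finrank_eq_finrank hd).mpr
      (LinearMap.lTensor_surjective K hf)
  -- The splitting makes the kernel a direct summand, so its fibre embeds in that of `P`. There it
  -- is killed by the fibre of `f`, which is injective by equality of dimensions.
  let q : P →ₗ[A] LinearMap.ker f := (LinearMap.id - s ∘ₗ f).codRestrict _ fun x => by
    have := DFunLike.congr_fun hs (f x)
    simp only [LinearMap.comp_apply, LinearMap.id_apply] at this
    simp [this]
  have hq : q ∘ₗ (LinearMap.ker f).subtype = LinearMap.id := by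
    ext x
    simp [q]
  refine ⟨fun x y => ?_⟩
  have key : ∀ x, (LinearMap.ker f).subtype.baseChange K x = 0 := fun x => by
    apply hinj
    rw [map_zero, ← LinearMap.comp_apply, ← LinearMap.baseChange_comp]
    have : f ∘ₗ (LinearMap.ker f).subtype = 0 := by ext x; simp
    rw [this, LinearMap.baseChange_zero, LinearMap.zero_apply]
  have key2 : ∀ x : K ⊗[A] LinearMap.ker f, x = 0 := fun x => by
    have := congrArg (q.baseChange K) (key x)
    rwa [map_zero, ← LinearMap.comp_apply, ← LinearMap.baseChange_comp, hq,
      LinearMap.baseChange_id] at this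
  rw [key2 x, key2 y]

end Nakayama

/-! ### Algebras whose fibres are regular representations -/

section RegularFibres

variable {A B H : Type} [CommRing A] [CommRing B] [Algebra A B] [Group H]

/-- The fibre of `B` over every point of `Spec A`, computed over some field with the corresponding
kernel, is the regular representation of `H`. -/
def HasRegularFibres (σ : H → B →ₐ[A] B) : Prop :=
  ∀ p : PrimeSpectrum A, ∃ (K : Type) (_ : Field K) (_ : Algebra A K),
    RingHom.ker (algebraMap A K) = p.asIdeal ∧
    ∃ φ : K ⊗[A] B ≃ₗ[K] MonoidAlgebra K H,
      ∀ g x, φ ((σ g).toLinearMap.baseChange K x) = MonoidAlgebra.single g 1 * φ x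

/-- Translation by `h` carries the coefficient at `1` to the coefficient at `h`, so all coefficients
agree. -/
theorem MonoidAlgebra.eq_smul_sum_of_forall_single_mul {K : Type*} [Semiring K] [Fintype H]
    {a : MonoidAlgebra K H} (ha : ∀ g, MonoidAlgebra.single g 1 * a = a) :
    ∃ c : K, a = c • ∑ g, MonoidAlgebra.single g (1 : K) := by
  classical
  refine ⟨a.coeff 1, ?_⟩
  ext h
  have := congrArg (fun b : MonoidAlgebra K H => b.coeff h) (ha h)
  simp only [MonoidAlgebra.coeff_single_mul_apply, one_mul, inv_mul_cancel] at this
  simp [← this]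

/-- A group algebra over a field is nonzero, so every fibre ring has a prime. With flatness this
yields faithful flatness, hence injectivity of `A → B`. -/
theorem HasRegularFibres.comap_surjective {σ : H → B →ₐ[A] B} (h : HasRegularFibres σ) :
    Function.Surjective (PrimeSpectrum.comap (algebraMap A B)) := by
  intro p
  obtain ⟨K, _, _, hK, φ, -⟩ := h p
  have : Nontrivial (K ⊗[A] B) := φ.toEquiv.nontrivial
  obtain ⟨q⟩ : Nonempty (PrimeSpectrum (K ⊗[A] B)) := inferInstance
  refine ⟨PrimeSpectrum.comap Algebra.TensorProduct.includeRight.toRingHom q, ?_⟩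
  rw [← PrimeSpectrum.comap_comp_apply]
  have : (Algebra.TensorProduct.includeRight (R := A) (A := K) (B := B)).toRingHom.comp
      (algebraMap A B) = (algebraMap K (K ⊗[A] B)).comp (algebraMap A K) := by
    ext x
    exact ((Algebra.TensorProduct.includeRight (R := A) (A := K) (B := B)).commutes x).trans
      (IsScalarTower.algebraMap_apply A K (K ⊗[A] B) x)
  rw [this, PrimeSpectrum.comap_comp_apply]
  have hbot : (PrimeSpectrum.comap (algebraMap K (K ⊗[A] B)) q).asIdeal = ⊥ :=
    (Ideal.eq_bot_or_top _).resolve_right (PrimeSpectrum.isPrime _).ne_top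
  ext1
  rw [PrimeSpectrum.comap_asIdeal, hbot, ← hK]
  rfl

theorem HasRegularFibres.algebraMap_injective {σ : H → B →ₐ[A] B} (h : HasRegularFibres σ)
    [Module.Flat A B] : Function.Injective (algebraMap A B) :=
  have := Module.FaithfullyFlat.of_comap_surjective h.comap_surjective
  FaithfulSMul.algebraMap_injective A B

/-- In a finite algebra whose fibres are regular representations, the invariants are the base. -/
theorem HasRegularFibres.mem_range_of_invariant [Finite H] [Module.Finite A B]
    {σ : H →* (B →ₐ[A] B)} (h : HasRegularFibres σ) (hH : IsUnit (Nat.card H : A)) {b : B}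
    (hb : ∀ g, σ g b = b) : b ∈ (algebraMap A B).range := by
  let _ := Fintype.ofFinite H
  obtain ⟨c, hc⟩ := hH.exists_left_inv
  let e : B →ₗ[A] B := c • ∑ g, (σ g).toLinearMap
  have he : ∀ x, (∀ g, σ g x = x) → e x = x := fun x hx => by
    simp only [e, LinearMap.smul_apply, LinearMap.sum_apply, AlgHom.toLinearMap_apply, hx,
      Finset.sum_const, Finset.card_univ, ← Nat.card_eq_fintype_card]
    rw [← Nat.cast_smul_eq_nsmul A, smul_smul, hc, one_smul]
  have hσe : ∀ g, (σ g).toLinearMap ∘ₗ e = e := fun g => by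
    ext x
    simp only [e, LinearMap.comp_apply, LinearMap.smul_apply, LinearMap.sum_apply,
      AlgHom.toLinearMap_apply, map_smul, map_sum]
    congr 1
    refine Fintype.sum_equiv (Equiv.mulLeft g) _ _ fun k => ?_
    rw [Equiv.coe_mulLeft, map_mul]
    rfl
  -- Once `L` is everything, write `b = (y - e y) + a • 1`; applying the averaging projector `e`
  -- kills the first summand and gives `b = a • 1`.
  let L : Submodule A B := LinearMap.range (LinearMap.id - e) ⊔ Submodule.span A {1}
  have hL : L = ⊤ := by
    rw [← Submodule.Quotient.subsingleton_iff]
    refine subsingleton_of_forall_fibre (A := A) fun p => ?_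
    obtain ⟨K, _, _, hK, φ, hφ⟩ := h p
    refine ⟨K, _, _, hK, ?_⟩
    have hinv : ∀ z : K ⊗[A] B, (∀ g, (σ g).toLinearMap.baseChange K z = z) →
        ∃ c : K, φ z = c • ∑ g, MonoidAlgebra.single g (1 : K) := fun z hz =>
      MonoidAlgebra.eq_smul_sum_of_forall_single_mul fun g => by rw [← hφ, hz]
    have : Nontrivial (K ⊗[A] B) := φ.toEquiv.nontrivial
    obtain ⟨u, hu⟩ := hinv 1 fun g => by
      rw [Algebra.TensorProduct.one_def, LinearMap.baseChange_tmul, AlgHom.toLinearMap_apply, map_one]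
    have hu0 : u ≠ 0 := by
      rintro rfl
      rw [zero_smul, map_eq_zero_iff _ φ.injective] at hu
      exact one_ne_zero hu
    -- In a fibre the invariants form a line, and `1` is a nonzero element of it, so every average
    -- is a multiple of `1`. Hence `L` surjects onto each fibre.
    have hfix : ∀ y : K ⊗[A] B, ∃ d : K, e.baseChange K y = d • 1 := fun y => by
      obtain ⟨d, hd⟩ := hinv (e.baseChange K y) fun g => by
        rw [← LinearMap.comp_apply, ← LinearMap.baseChange_comp, hσe]
      refine ⟨d * u⁻¹, φ.injective ?_⟩
      rw [map_smul, hu, hd, smul_smul, inv_mul_cancel_right₀ hu0]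
    have hm : L.mkQ ∘ₗ (LinearMap.id - e) = 0 := by
      ext x
      exact (Submodule.Quotient.mk_eq_zero L).mpr (Submodule.mem_sup_left ⟨x, rfl⟩)
    have hzero : ∀ y : K ⊗[A] B, L.mkQ.baseChange K y = 0 := fun y => by
      obtain ⟨d, hd⟩ := hfix y
      have h1 : L.mkQ.baseChange K ((LinearMap.id - e).baseChange K y) = 0 := by
        rw [← LinearMap.comp_apply, ← LinearMap.baseChange_comp, hm, LinearMap.baseChange_zero,
          LinearMap.zero_apply]
      rw [LinearMap.baseChange_sub, LinearMap.baseChange_id, LinearMap.sub_apply,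
        LinearMap.id_apply, map_sub, hd, sub_eq_zero] at h1
      rw [h1, map_smul, Algebra.TensorProduct.one_def, LinearMap.baseChange_tmul, 
        show L.mkQ 1 = 0 from (Submodule.Quotient.mk_eq_zero L).mpr
          (Submodule.mem_sup_right (Submodule.mem_span_singleton_self 1)), tmul_zero, smul_zero]
    refine ⟨fun x y => ?_⟩
    obtain ⟨x, rfl⟩ := LinearMap.lTensor_surjective K L.mkQ_surjective x
    obtain ⟨y, rfl⟩ := LinearMap.lTensor_surjective K L.mkQ_surjective y
    exact (hzero x).trans (hzero y).symm
  have hbL : b ∈ L := hL ▸ Submodule.mem_top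
  obtain ⟨_, ⟨y, rfl⟩, z, hz, hyz⟩ := Submodule.mem_sup.mp hbL
  obtain ⟨a, rfl⟩ := Submodule.mem_span_singleton.mp hz
  have h2 : e b = a • 1 := by
    rw [← hyz, map_add, LinearMap.sub_apply, map_sub, LinearMap.id_apply,
      he (e y) (fun g => DFunLike.congr_fun (hσe g) y), sub_self, zero_add, map_smul,
      he 1 fun g => map_one _]
  exact ⟨a, by rw [Algebra.algebraMap_eq_smul_one, ← h2, he b hb]⟩

end RegularFibres

/-! ### Affine families as base changes of the quotient family -/

section AffineFamily

/-- The universal property gives a map from the pushout to the generated subring, and its composite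
with the inclusion is the identity. -/
theorem closure_range_union_range_of_isPushout {A B C P : CommRingCat.{0}} {f : A ⟶ B} {g : A ⟶ C}
    {i : B ⟶ P} {j : C ⟶ P} (h : IsPushout f g i j) :
    Subring.closure (Set.range i.hom ∪ Set.range j.hom) = ⊤ := by
  let T := Subring.closure (Set.range i.hom ∪ Set.range j.hom)
  let i' : B ⟶ CommRingCat.of T := CommRingCat.ofHom (i.hom.codRestrict T fun x =>
    Subring.subset_closure (Or.inl ⟨x, rfl⟩))
  let j' : C ⟶ CommRingCat.of T := CommRingCat.ofHom (j.hom.codRestrict T fun x =>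
    Subring.subset_closure (Or.inr ⟨x, rfl⟩))
  have hi : i' ≫ CommRingCat.ofHom T.subtype = i := rfl
  have hj : j' ≫ CommRingCat.ofHom T.subtype = j := rfl
  have hw : f ≫ i' = g ≫ j' := by
    refine CommRingCat.hom_ext (RingHom.ext fun x => Subtype.ext ?_)
    exact congrArg (fun k => k.hom x) h.w
  have hid : h.desc i' j' hw ≫ CommRingCat.ofHom T.subtype = 𝟙 P := by
    apply h.hom_ext
    · rw [h.inl_desc_assoc, hi, Category.comp_id]
    · rw [h.inr_desc_assoc, hj, Category.comp_id]
  refine eq_top_iff.mpr fun x _ => ?_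
  have hx : ((h.desc i' j' hw).hom x : P) = x := congrArg (fun k => k.hom x) hid
  exact hx ▸ ((h.desc i' j' hw).hom x).2

variable {n : ℕ} {G : Subgroup (GL (Fin n) ℂ)}

/-- A family of regular representations generated by the coordinate functions is the base change
of the quotient family. -/
theorem isPushout_of_hasRegularFibres (hG : IsComplexReflectionGroup G) {A B : Type}
    [CommRing A] [IsNoetherianRing A] [CommRing B] [Algebra A B] [Module.Finite A B]
    [Module.Flat A B] [Algebra (invariants G) A] [Algebra (MvPolynomial (Fin n) ℂ) B]
    [IsScalarTower (invariants G) A B]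
    {σ : G → B →ₐ[A] B} (h : HasRegularFibres σ)
    (hgen : Subring.closure (Set.range (algebraMap A B) ∪
      Set.range (algebraMap (MvPolynomial (Fin n) ℂ) B)) = ⊤) :
    Algebra.IsPushout (invariants G) A (MvPolynomial (Fin n) ℂ) B := by
  have := hG.1
  have := Module.finitePresentation_of_finite A B
  have : Module.Projective A B := Module.Flat.projective_of_finitePresentation
  let f : A ⊗[invariants G] MvPolynomial (Fin n) ℂ →ₐ[A] B :=
    Algebra.TensorProduct.lift (Algebra.ofId A B)
      (IsScalarTower.toAlgHom (invariants G) (MvPolynomial (Fin n) ℂ) B) fun _ _ => .all _ _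
  have hf : Function.Surjective f := by
    rw [← RingHom.coe_coe, ← RingHom.range_eq_top, eq_top_iff, ← hgen, Subring.closure_le]
    rintro _ (⟨x, rfl⟩ | ⟨x, rfl⟩)
    · exact ⟨x ⊗ₜ 1, by simp [f, Algebra.ofId_apply]⟩
    · exact ⟨1 ⊗ₜ x, by simp [f]⟩
  have hinj : Function.Injective f.toLinearMap := by
    refine injective_of_surjective_of_finrank_eq f.toLinearMap hf fun p => ?_
    obtain ⟨K, _, _, hK, φ, -⟩ := h p
    refine ⟨K, _, _, hK, ?_⟩
    let _ : Algebra (invariants G) K :=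
      ((algebraMap A K).comp (algebraMap (invariants G) A)).toAlgebra
    have : IsScalarTower (invariants G) A K := IsScalarTower.of_algebraMap_eq' rfl
    -- Both fibres have dimension the order of `G`: one by `finrank_fibre`, the other because it is
    -- the group algebra.
    rw [(TensorProduct.AlgebraTensorModule.cancelBaseChange (invariants G) A K K
      (MvPolynomial (Fin n) ℂ)).finrank_eq, finrank_fibre hG, φ.finrank_eq,
      Module.finrank_eq_nat_card_basis (MonoidAlgebra.basis G K)]
  exact ⟨IsBaseChange.of_equiv (LinearEquiv.ofBijective f.toLinearMap ⟨hinj, hf⟩) fun x => by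
    change f (1 ⊗ₜ x) = _
    simp [f]⟩

/-- The fibre of a family with group action, given by a pushout square of rings, as a
representation. -/
structure IsRegularFibre {G : Type} [Group G] {A B : CommRingCat.{0}} (α : A ⟶ B) (σ : G → (B ⟶ B))
    {K C : CommRingCat.{0}} (κ : A ⟶ K) (γ : B ⟶ C) (δ : K ⟶ C) : Prop where
  isPushout : IsPushout α κ γ δ
  exists_equiv : ∃ (τ : G → (C ⟶ C)) (φ : C ≃+ MonoidAlgebra K G),
    (∀ g, γ ≫ τ g = σ g ≫ γ) ∧ (∀ g, δ ≫ τ g = δ) ∧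
    (∀ c f, φ (δ.hom c * f) = c • φ f) ∧
    ∀ g f, φ ((τ g).hom f) = MonoidAlgebra.single g 1 * φ f

theorem IsRegularFibre.exists_linearEquiv {H : Type} [Group H] {A B C K : Type} [CommRing A]
    [CommRing B] [CommRing C] [Field K] [Algebra A B] [Algebra A K] (σ : H → B →ₐ[A] B)
    {γ : B →+* C} {δ : K →+* C}
    (h : IsRegularFibre (CommRingCat.ofHom (algebraMap A B))
      (fun g => CommRingCat.ofHom (σ g).toRingHom) (CommRingCat.ofHom (algebraMap A K))
      (CommRingCat.ofHom γ) (CommRingCat.ofHom δ)) :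
    ∃ φ : K ⊗[A] B ≃ₗ[K] MonoidAlgebra K H,
      ∀ g x, φ ((σ g).toLinearMap.baseChange K x) = MonoidAlgebra.single g 1 * φ x := by
  let _ : Algebra B C := γ.toAlgebra
  let _ : Algebra K C := δ.toAlgebra
  let _ : Algebra A C := (γ.comp (algebraMap A B)).toAlgebra
  have : IsScalarTower A B C := IsScalarTower.of_algebraMap_eq' rfl
  have : IsScalarTower A K C := IsScalarTower.of_algebraMap_eq'
    (congrArg CommRingCat.Hom.hom h.isPushout.w)
  have hp : Algebra.IsPushout A K B C :=
    CommRingCat.isPushout_iff_isPushout.mp h.isPushout.flip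
  let e := Algebra.IsPushout.equiv A K B C
  obtain ⟨τ, φ, h1, h2, h3, h4⟩ := h.exists_equiv
  let φ' : C ≃ₗ[K] MonoidAlgebra K H := { φ with map_smul' := fun c f => h3 c f }
  refine ⟨e.toLinearEquiv.trans φ', fun g x => ?_⟩
  change φ (e _) = _ * φ (e x)
  rw [← h4]
  congr 1
  induction x with
  | zero => simp
  | add x y hx hy => rw [map_add, map_add, map_add, hx, hy, map_add]
  | tmul c b =>
    rw [LinearMap.baseChange_tmul, Algebra.IsPushout.equiv_tmul, Algebra.IsPushout.equiv_tmul,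
      map_mul]
    congr 1
    · exact (congrArg (fun k => k.hom c) (h2 g)).symm
    · exact (congrArg (fun k => k.hom b) (h1 g)).symm

theorem exists_ringHom_of_forall_mem_range {R A B : Type*} [CommRing R] [CommRing A] [CommRing B]
    {α : A →+* B} (hα : Function.Injective α) (β : R →+* B) (h : ∀ r, β r ∈ α.range) :
    ∃ ψ : R →+* A, ∀ r, α (ψ r) = β r := by
  let e := RingEquiv.ofBijective α.rangeRestrict
    ⟨fun x y hxy => hα (congrArg Subtype.val hxy), α.rangeRestrict_surjective⟩
  exact ⟨e.symm.toRingHom.comp (β.codRestrict α.range h), fun r =>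
    congrArg Subtype.val (e.apply_symm_apply ⟨β r, h r⟩)⟩

theorem ofHom_groupSubst_one : CommRingCat.ofHom (groupSubst G 1).toRingHom =
    𝟙 (CommRingCat.of (MvPolynomial (Fin n) ℂ)) :=
  CommRingCat.hom_ext (RingHom.ext fun f => DFunLike.congr_fun (groupSubst_one G) f)

theorem ofHom_groupSubst_mul (g h : G) : CommRingCat.ofHom (groupSubst G (g * h)).toRingHom =
    CommRingCat.ofHom (groupSubst G g).toRingHom ≫ CommRingCat.ofHom (groupSubst G h).toRingHom :=
  CommRingCat.hom_ext (RingHom.ext fun f => DFunLike.congr_fun (groupSubst_mul G g h) f)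

/-- Affine families of clusters come from the quotient family. -/
theorem exists_isPushout_of_isRegularFibre (hG : IsComplexReflectionGroup G)
    {A B : CommRingCat.{0}} [IsNoetherianRing A] {α : A ⟶ B} (hfin : α.hom.Finite)
    (hflat : α.hom.Flat)
    {β : CommRingCat.of (MvPolynomial (Fin n) ℂ) ⟶ B} {c : CommRingCat.of ℂ ⟶ A}
    (hc : CommRingCat.ofHom (algebraMap ℂ (MvPolynomial (Fin n) ℂ)) ≫ β = c ≫ α)
    (hgen : Subring.closure (Set.range α.hom ∪ Set.range β.hom) = ⊤)
    (σ : G → (B ⟶ B)) (hα : ∀ g, α ≫ σ g = α)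
    (hβ : ∀ g, β ≫ σ g = CommRingCat.ofHom (groupSubst G g⁻¹).toRingHom ≫ β)
    (hfib : ∀ p : PrimeSpectrum A, ∃ (K C : CommRingCat.{0}) (κ : A ⟶ K) (γ : B ⟶ C) (δ : K ⟶ C),
      IsField K ∧ RingHom.ker κ.hom = p.asIdeal ∧ IsRegularFibre α σ κ γ δ) :
    Function.Surjective (PrimeSpectrum.comap α.hom) ∧
    ∃ ψ : CommRingCat.of (invariants G) ⟶ A,
      CommRingCat.ofHom (algebraMap ℂ (invariants G)) ≫ ψ = c ∧
      IsPushout (CommRingCat.ofHom (invariants G).val.toRingHom) ψ β α := by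
  have := hG.1
  let _ : Algebra A B := α.hom.toAlgebra
  have : Module.Finite A B := hfin
  have : Module.Flat A B := hflat
  -- `B` is generated by the base and the coordinates, so the action laws for `σ` follow from their
  -- known values there.
  have hext (f g : B ⟶ B) (h1 : α ≫ f = α ≫ g) (h2 : β ≫ f = β ≫ g) : f = g := by
    ext1
    refine RingHom.eq_of_eqOn_set_dense hgen ?_
    rintro _ (⟨x, rfl⟩ | ⟨x, rfl⟩)
    · exact congrArg (fun k => k.hom x) h1
    · exact congrArg (fun k => k.hom x) h2
  have hone : σ 1 = 𝟙 B := by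
    refine hext _ _ (by rw [hα, Category.comp_id]) ?_
    rw [hβ, inv_one, ofHom_groupSubst_one, Category.comp_id, Category.id_comp]
  have hmul (g k : G) : σ (g * k) = σ k ≫ σ g := by
    refine hext _ _ (by simp only [← Category.assoc, hα]) ?_
    rw [reassoc_of% hβ k, hβ, hβ, mul_inv_rev, ofHom_groupSubst_mul, Category.assoc]
  let σ' : G →* (B →ₐ[A] B) :=
    { toFun := fun g => { (σ g).hom with commutes' := fun a => congrArg (fun k => k.hom a) (hα g) }
      map_one' := AlgHom.ext fun b => congrArg (fun k => k.hom b) hone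
      map_mul' := fun g k => AlgHom.ext fun b => congrArg (fun f => f.hom b) (hmul g k) }
  have hreg : HasRegularFibres σ' := fun p => by
    obtain ⟨K, C, κ, γ, δ, hK, hker, hF⟩ := hfib p
    let _ := hK.toField
    let _ : Algebra A K := κ.hom.toAlgebra
    refine ⟨K, _, _, hker, ?_⟩
    exact IsRegularFibre.exists_linearEquiv (γ := γ.hom) (δ := δ.hom) σ' hF
  refine ⟨hreg.comap_surjective, ?_⟩
  have hinj : Function.Injective α.hom := hreg.algebraMap_injective
  have hunit : IsUnit (Nat.card G : A) := by
    rw [← map_natCast c.hom]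
    exact (IsUnit.mk0 (Nat.card G : ℂ) (by exact_mod_cast Nat.card_pos.ne')).map c.hom
  -- The image of an invariant polynomial is a `G`-invariant element of `B`, hence comes from `A`.
  -- This defines the classifying map `ψ`.
  have hrange (r : invariants G) : β.hom (r : MvPolynomial (Fin n) ℂ) ∈ α.hom.range := by
    refine hreg.mem_range_of_invariant hunit fun g => ?_
    have := congrArg (fun k => k.hom (r : MvPolynomial (Fin n) ℂ)) (hβ g)
    refine this.trans (congrArg β.hom ?_)
    exact (groupSubst G g⁻¹).commutes r
  obtain ⟨ψ, hψ⟩ := exists_ringHom_of_forall_mem_range hinj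
    (β.hom.comp (invariants G).val.toRingHom) hrange
  refine ⟨CommRingCat.ofHom ψ, ?_, ?_⟩
  · ext x
    apply hinj
    exact (hψ _).trans (congrArg (fun k => k.hom x) hc)
  · let _ : Algebra (invariants G) A := ψ.toAlgebra
    let _ : Algebra (MvPolynomial (Fin n) ℂ) B := β.hom.toAlgebra
    have : IsScalarTower (invariants G) A B :=
      IsScalarTower.of_algebraMap_eq fun r => (hψ r).symm
    have := isPushout_of_hasRegularFibres hG hreg hgen
    exact (CommRingCat.isPushout_iff_isPushout.mpr this).flip

end AffineFamily

/-! ### Base change and group action on closed subschemes -/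

section Families

variable {n : ℕ}

/-- The projection to `ℂⁿ` of the closed subscheme of `S × ℂⁿ` with ideal sheaf `I`. -/
def coord {S : Over SpecC} (I : (prodAffine n S).IdealSheafData) :
    I.subscheme ⟶ (affineSpace n).left :=
  I.subschemeι ≫ pullback.snd S.hom (affineSpace n).hom

@[simp]
theorem baseChange_fst {T S : Over SpecC} (f : T ⟶ S) :
    baseChange n f ≫ pullback.fst _ _ = pullback.fst _ _ ≫ f.left :=
  pullback.lift_fst _ _ _

@[simp]
theorem baseChange_fst_assoc {T S : Over SpecC} (f : T ⟶ S)
    {W : Scheme.{0}} (h : _ ⟶ W) :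
    baseChange n f ≫ pullback.fst _ _ ≫ h =
      pullback.fst _ _ ≫ f.left ≫ h := by
  rw [← Category.assoc, baseChange_fst, Category.assoc]

@[simp]
theorem baseChange_snd {T S : Over SpecC} (f : T ⟶ S) :
    baseChange n f ≫ pullback.snd _ _ = pullback.snd _ _ :=
  (pullback.lift_snd _ _ _).trans (Category.comp_id _)

@[simp]
theorem baseChange_snd_assoc {T S : Over SpecC} (f : T ⟶ S)
    {W : Scheme.{0}} (h : _ ⟶ W) :
    baseChange n f ≫ pullback.snd _ _ ≫ h =
      pullback.snd _ _ ≫ h := by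
  rw [← Category.assoc, baseChange_snd]

@[simp]
theorem actProd_fst (S : Over SpecC) (A : Matrix (Fin n) (Fin n) ℂ) :
    actProd S A ≫ pullback.fst _ _ = pullback.fst _ _ :=
  (pullback.lift_fst _ _ _).trans (Category.comp_id _)

@[simp]
theorem actProd_fst_assoc (S : Over SpecC) (A : Matrix (Fin n) (Fin n) ℂ)
    {W : Scheme.{0}} (h : _ ⟶ W) :
    actProd S A ≫ pullback.fst _ _ ≫ h =
      pullback.fst _ _ ≫ h := by
  rw [← Category.assoc, actProd_fst]

@[simp]
theorem actProd_snd (S : Over SpecC) (A : Matrix (Fin n) (Fin n) ℂ) :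
    actProd S A ≫ pullback.snd _ _ = pullback.snd _ _ ≫ (linMap A).left :=
  pullback.lift_snd _ _ _

@[simp]
theorem actProd_snd_assoc (S : Over SpecC) (A : Matrix (Fin n) (Fin n) ℂ)
    {W : Scheme.{0}} (h : _ ⟶ W) :
    actProd S A ≫ pullback.snd _ _ ≫ h =
      pullback.snd _ _ ≫ (linMap A).left ≫ h := by
  rw [← Category.assoc, actProd_snd, Category.assoc]

theorem baseChange_id (S : Over SpecC) : baseChange n (𝟙 S) = 𝟙 _ := by
  apply pullback.hom_ext <;> simp

theorem baseChange_comp {T S U : Over SpecC} (f : T ⟶ S) (g : S ⟶ U) :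
    baseChange n (f ≫ g) = baseChange n f ≫ baseChange n g := by
  apply pullback.hom_ext <;> simp

theorem actProd_baseChange {T S : Over SpecC} (f : T ⟶ S) (A : Matrix (Fin n) (Fin n) ℂ) :
    actProd T A ≫ baseChange n f = baseChange n f ≫ actProd S A := by
  apply pullback.hom_ext <;> simp

theorem isPullback_baseChange {T S : Over SpecC} (f : T ⟶ S) :
    IsPullback (baseChange n f) (pullback.fst _ _) (pullback.fst _ _) f.left := by
  refine IsPullback.of_right ?_ (baseChange_fst f)
    (IsPullback.of_hasPullback S.hom (affineSpace n).hom).flip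
  rw [baseChange_snd, Over.w]
  exact (IsPullback.of_hasPullback T.hom (affineSpace n).hom).flip

/-- The map from the pulled back closed subscheme. -/
def comapMap {T S : Over SpecC} (I : (prodAffine n S).IdealSheafData) (f : T ⟶ S) :
    (I.comap (baseChange n f)).subscheme ⟶ I.subscheme :=
  Scheme.IdealSheafData.subschemeMap _ _ (baseChange n f) (I.le_map_comap _)

@[simp]
theorem comapMap_subschemeι {T S : Over SpecC} (I : (prodAffine n S).IdealSheafData) (f : T ⟶ S) :
    comapMap I f ≫ I.subschemeι = (I.comap (baseChange n f)).subschemeι ≫ baseChange n f :=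
  Scheme.IdealSheafData.subschemeMap_subschemeι ..

@[simp]
theorem comapMap_subschemeι_assoc {T S : Over SpecC} (I : (prodAffine n S).IdealSheafData) (f : T ⟶ S)
    {W : Scheme.{0}} (h : _ ⟶ W) :
    comapMap I f ≫ I.subschemeι ≫ h =
      (I.comap (baseChange n f)).subschemeι ≫ baseChange n f ≫ h := by
  rw [← Category.assoc, comapMap_subschemeι, Category.assoc]

@[simp]
theorem comapMap_coord {T S : Over SpecC} (I : (prodAffine n S).IdealSheafData) (f : T ⟶ S) :
    comapMap I f ≫ coord I = coord (I.comap (baseChange n f)) := by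
  simp [coord]

@[simp]
theorem comapMap_coord_assoc {T S : Over SpecC} (I : (prodAffine n S).IdealSheafData) (f : T ⟶ S)
    {W : Scheme.{0}} (h : _ ⟶ W) :
    comapMap I f ≫ coord I ≫ h =
      coord (I.comap (baseChange n f)) ≫ h := by
  rw [← Category.assoc, comapMap_coord]

theorem isPullback_comapMap {T S : Over SpecC} (I : (prodAffine n S).IdealSheafData) (f : T ⟶ S) :
    IsPullback (comapMap I f) (proj (I.comap (baseChange n f))) (proj I) f.left := by
  have h : IsPullback (comapMap I f) (I.comap (baseChange n f)).subschemeι I.subschemeι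
      (baseChange n f) := by
    refine (isPullback_of_isClosedImmersion _ _ _ _ (comapMap_subschemeι I f).symm ?_).flip
    rw [Scheme.IdealSheafData.ker_subschemeι, Scheme.IdealSheafData.ker_subschemeι]
  exact h.paste_vert (isPullback_baseChange f)

variable {G : Subgroup (GL (Fin n) ℂ)}

theorem IsInvariant.comap {T S : Over SpecC} {I : (prodAffine n S).IdealSheafData}
    (hI : IsInvariant G I) (f : T ⟶ S) : IsInvariant G (I.comap (baseChange n f)) := by
  intro g hg
  rw [← Scheme.IdealSheafData.comap_comp, actProd_baseChange, Scheme.IdealSheafData.comap_comp,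
    hI g hg]

section Action

variable {S : Over SpecC} {I : (prodAffine n S).IdealSheafData} (hI : IsInvariant G I)

@[simp]
theorem actSub_subschemeι (g : G) :
    actSub hI g ≫ I.subschemeι =
      I.subschemeι ≫ actProd S ((g : GL (Fin n) ℂ) : Matrix (Fin n) (Fin n) ℂ) :=
  Scheme.IdealSheafData.subschemeMap_subschemeι ..

@[simp]
theorem actSub_subschemeι_assoc (g : G)
    {W : Scheme.{0}} (h : _ ⟶ W) :
    actSub hI g ≫ I.subschemeι ≫ h =
      I.subschemeι ≫ actProd S ((g : GL (Fin n) ℂ) : Matrix (Fin n) (Fin n) ℂ) ≫ h := by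
  rw [← Category.assoc, actSub_subschemeι, Category.assoc]

@[simp]
theorem actSub_proj (g : G) : actSub hI g ≫ proj I = proj I := by
  simp [proj]

@[simp]
theorem actSub_coord (g : G) : actSub hI g ≫ coord I =
    coord I ≫ (linMap ((g : GL (Fin n) ℂ) : Matrix (Fin n) (Fin n) ℂ)).left := by
  simp [coord]

theorem actSub_comapMap {T : Over SpecC} (f : T ⟶ S) (g : G) :
    actSub (hI.comap f) g ≫ comapMap I f = comapMap I f ≫ actSub hI g := by
  rw [← cancel_mono I.subschemeι]
  simp [actProd_baseChange]

end Action

/-- A map to the product is determined by its two components, so the isomorphism respects the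
embeddings, and the ideals are kernels of the same map. -/
theorem eq_of_iso {S : Over SpecC} {I J : (prodAffine n S).IdealSheafData}
    (e : I.subscheme ≅ J.subscheme) (h₁ : e.hom ≫ proj J = proj I)
    (h₂ : e.hom ≫ coord J = coord I) : I = J := by
  have : e.hom ≫ J.subschemeι = I.subschemeι := by
    apply pullback.hom_ext
    · simpa [proj] using h₁
    · simpa [coord] using h₂
  rw [← I.ker_subschemeι, ← this, Scheme.Hom.ker_comp_of_isIso, J.ker_subschemeι]

end Families

/-! ### The quotient family and its pullbacks -/

section QuotientFamily

variable {n : ℕ} (G : Subgroup (GL (Fin n) ℂ))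

/-- The embedding `(p, id)` of `ℂⁿ` into `ℂⁿ/G × ℂⁿ`. -/
def quotientGraph : (affineSpace n).left ⟶ prodAffine n (quotientVariety G) :=
  pullback.lift (f := (quotientVariety G).hom) (g := (affineSpace n).hom)
    (quotientMap G).left (𝟙 _) (by simp)

@[simp]
theorem quotientGraph_fst : quotientGraph G ≫ pullback.fst _ _ = (quotientMap G).left :=
  pullback.lift_fst _ _ _

@[simp]
theorem quotientGraph_snd : quotientGraph G ≫ pullback.snd _ _ = 𝟙 _ :=
  pullback.lift_snd _ _ _

@[simp]
theorem quotientGraph_snd_assoc {W : Scheme.{0}} (h : _ ⟶ W) :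
    quotientGraph G ≫ pullback.snd _ _ ≫ h =
      h := by
  rw [← Category.assoc, quotientGraph_snd, Category.id_comp]

instance : IsAffine (affineSpace n).left := inferInstanceAs (IsAffine (Spec _))
instance : IsAffine (quotientVariety G).left := inferInstanceAs (IsAffine (Spec _))

instance : IsClosedImmersion (quotientGraph G) := by
  have : IsClosedImmersion (quotientGraph G ≫ pullback.snd _ _) := by
    rw [quotientGraph_snd]; infer_instance
  exact IsClosedImmersion.of_comp _ (pullback.snd (quotientVariety G).hom (affineSpace n).hom)

/-- The universal family is isomorphic to `ℂⁿ`. -/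
def quotientFamilyIso : (affineSpace n).left ≅ (quotientFamily G).subscheme :=
  let e := asIso (quotientGraph G).toImage
  e

@[simp]
theorem quotientFamilyIso_hom_subschemeι :
    (quotientFamilyIso G).hom ≫ (quotientFamily G).subschemeι = quotientGraph G :=
  (quotientGraph G).toImage_imageι

@[simp]
theorem quotientFamilyIso_hom_subschemeι_assoc {W : Scheme.{0}} (h : _ ⟶ W) :
    (quotientFamilyIso G).hom ≫ (quotientFamily G).subschemeι ≫ h =
      quotientGraph G ≫ h := by
  rw [← Category.assoc, quotientFamilyIso_hom_subschemeι]

theorem quotientFamilyIso_hom_proj :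
    (quotientFamilyIso G).hom ≫ proj (quotientFamily G) = (quotientMap G).left := by
  rw [proj, quotientFamilyIso_hom_subschemeι_assoc, quotientGraph_fst]

theorem quotientFamilyIso_hom_coord :
    (quotientFamilyIso G).hom ≫ coord (quotientFamily G) = 𝟙 _ := by
  rw [coord, quotientFamilyIso_hom_subschemeι_assoc, quotientGraph_snd]

variable {G}

/-- A closed subscheme `Z ⊆ S × ℂⁿ` is pulled back from the universal family along `f` if and only
if it is the fibre product of `S` and `ℂⁿ` over `ℂⁿ/G`. -/
theorem comap_quotientFamily_eq_iff {S : Over SpecC} {I : (prodAffine n S).IdealSheafData}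
    {f : S ⟶ quotientVariety G} :
    (quotientFamily G).comap (baseChange n f) = I ↔
      IsPullback (coord I) (proj I) (quotientMap G).left f.left := by
  -- The family over the quotient itself gives the trivial Cartesian square; pasting it with the
  -- base change square gives the general one.
  have key : IsPullback (coord ((quotientFamily G).comap (baseChange n f)))
      (proj ((quotientFamily G).comap (baseChange n f))) (quotientMap G).left f.left := by
    have h : IsPullback (coord (quotientFamily G)) (proj (quotientFamily G)) (quotientMap G).left
        (𝟙 _) := by
      have : coord (quotientFamily G) = (quotientFamilyIso G).inv := by
        rw [← cancel_epi (quotientFamilyIso G).hom, quotientFamilyIso_hom_coord, Iso.hom_inv_id]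
      rw [this]
      refine IsPullback.of_horiz_isIso ⟨?_⟩
      rw [Category.comp_id, Iso.inv_comp_eq, quotientFamilyIso_hom_proj]
    have := (isPullback_comapMap (quotientFamily G) f).paste_horiz h
    rwa [comapMap_coord, Category.comp_id] at this
  refine ⟨fun h => h ▸ key, fun h => ?_⟩
  exact eq_of_iso (key.isoIsPullback _ _ h) (key.isoIsPullback_hom_snd _ _ h)
    (key.isoIsPullback_hom_fst _ _ h)

theorem linMap_quotientMap {A : GL (Fin n) ℂ} (hA : A ∈ G) :
    (linMap (A : Matrix (Fin n) (Fin n) ℂ)).left ≫ (quotientMap G).left = (quotientMap G).left := by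
  change Spec.map _ ≫ Spec.map _ = Spec.map _
  rw [← Spec.map_comp]
  congr 1
  exact CommRingCat.hom_ext (RingHom.ext fun r => r.2 A hA)

theorem linMap_comp_linMap_inv (A : GL (Fin n) ℂ) :
    (linMap (A : Matrix (Fin n) (Fin n) ℂ)).left ≫
      (linMap ((A⁻¹ : GL (Fin n) ℂ) : Matrix (Fin n) (Fin n) ℂ)).left = 𝟙 _ := by
  have h (f) : linSubst (A : Matrix (Fin n) (Fin n) ℂ)
      (linSubst ((A⁻¹ : GL (Fin n) ℂ) : Matrix (Fin n) (Fin n) ℂ) f) = f := by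
    rw [linSubst_linSubst, ← Units.val_mul, inv_mul_cancel, Units.val_one, linSubst_one]
  have h' : (linSubst (A : Matrix (Fin n) (Fin n) ℂ)).toRingHom.comp
      (linSubst ((A⁻¹ : GL (Fin n) ℂ) : Matrix (Fin n) (Fin n) ℂ)).toRingHom = RingHom.id _ :=
    RingHom.ext h
  change Spec.map (CommRingCat.ofHom _) ≫ Spec.map (CommRingCat.ofHom _) = 𝟙 (Spec _)
  rw [← Spec.map_comp, ← CommRingCat.ofHom_comp, h', CommRingCat.ofHom_id, Spec.map_id]

/-- Equivariance of the graph gives one inclusion of ideals for each `g`; the reverse one is the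
inclusion for `g⁻¹` pulled back along `g`. -/
theorem isInvariant_quotientFamily : IsInvariant G (quotientFamily G) := by
  have hle : ∀ g ∈ G, (quotientFamily G).comap
      (actProd _ (g : Matrix (Fin n) (Fin n) ℂ)) ≤ quotientFamily G := fun g hg => by
    rw [← Scheme.IdealSheafData.le_map_iff_comap_le]
    have : quotientGraph G ≫ actProd _ (g : Matrix (Fin n) (Fin n) ℂ) =
        (linMap (g : Matrix (Fin n) (Fin n) ℂ)).left ≫ quotientGraph G := by
      apply pullback.hom_ext
      · simp [linMap_quotientMap hg]
      · simp
    change quotientFamily G ≤ (quotientGraph G).ker.map _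
    rw [Scheme.IdealSheafData.map_ker, this]
    exact Scheme.Hom.le_ker_comp _ _
  intro g hg
  refine le_antisymm (hle g hg) ?_
  have h := Scheme.IdealSheafData.comap_mono
    (actProd (quotientVariety G) (g : Matrix (Fin n) (Fin n) ℂ)) (hle g⁻¹ (inv_mem hg))
  have hact : actProd (quotientVariety G) (g : Matrix (Fin n) (Fin n) ℂ) ≫
      actProd (quotientVariety G) ((g⁻¹ : GL (Fin n) ℂ) : Matrix (Fin n) (Fin n) ℂ) = 𝟙 _ := by
    apply pullback.hom_ext
    · simp
    · rw [Category.assoc, actProd_snd, actProd_snd_assoc, linMap_comp_linMap_inv, Category.comp_id,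
        Category.id_comp]
  simpa only [← Scheme.IdealSheafData.comap_comp, hact, Scheme.IdealSheafData.comap_id] using h

end QuotientFamily

/-! ### Translation between fibre products of schemes and pushouts of rings -/

section GlobalFunctions

/-- The homomorphism `A ⟶ Γ(Z)` corresponding to a morphism `Z ⟶ Spec A`. -/
def gammaHom {Z : Scheme.{0}} {A : CommRingCat.{0}} (a : Z ⟶ Spec A) : A ⟶ Γ(Z, ⊤) :=
  (Scheme.ΓSpecIso A).inv ≫ a.appTop

theorem toSpecΓ_gammaHom {Z : Scheme.{0}} {A : CommRingCat.{0}} (a : Z ⟶ Spec A) :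
    Z.toSpecΓ ≫ Spec.map (gammaHom a) = a := by
  rw [gammaHom, Spec.map_comp, ← Scheme.toSpecΓ_naturality_assoc]
  simp

theorem gammaHom_comp {Z W : Scheme.{0}} {A : CommRingCat.{0}} (f : W ⟶ Z) (a : Z ⟶ Spec A) :
    gammaHom (f ≫ a) = gammaHom a ≫ f.appTop := by
  simp [gammaHom]

theorem gammaHom_SpecMap {Z : Scheme.{0}} {A B : CommRingCat.{0}} (a : Z ⟶ Spec B) (f : A ⟶ B) :
    gammaHom (a ≫ Spec.map f) = f ≫ gammaHom a := by
  simp [gammaHom, Scheme.ΓSpecIso_inv_naturality_assoc]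

theorem isPushout_gammaHom {Z W : Scheme.{0}} [IsAffine Z] {A K : CommRingCat.{0}} {f : W ⟶ Z}
    {w : W ⟶ Spec K} {a : Z ⟶ Spec A} {κ : A ⟶ K} (h : IsPullback f w a (Spec.map κ)) :
    IsPushout (gammaHom a) κ f.appTop (gammaHom w) := by
  refine IsPushout.of_iso (isPushout_appTop_of_isPullback h) (Scheme.ΓSpecIso A) (Iso.refl _)
    (Scheme.ΓSpecIso K) (Iso.refl _) ?_ ?_ ?_ ?_
  · simp [gammaHom]
  · exact Scheme.ΓSpecIso_naturality κ
  · simp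
  · simp [gammaHom]

theorem isPushout_gammaHom_gammaHom {W : Scheme.{0}} {A B K : CommRingCat.{0}} {b : W ⟶ Spec B}
    {w : W ⟶ Spec K} {f : A ⟶ B} {κ : A ⟶ K} (h : IsPullback b w (Spec.map f) (Spec.map κ)) :
    IsPushout f κ (gammaHom b) (gammaHom w) := by
  refine IsPushout.of_iso (isPushout_appTop_of_isPullback h) (Scheme.ΓSpecIso A)
    (Scheme.ΓSpecIso B) (Scheme.ΓSpecIso K) (Iso.refl _) ?_ ?_ ?_ ?_
  · exact Scheme.ΓSpecIso_naturality f
  · exact Scheme.ΓSpecIso_naturality κ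
  · simp [gammaHom]
  · simp [gammaHom]

theorem isPullback_of_isPushout_gammaHom {W : Scheme.{0}} [IsAffine W] {A B K : CommRingCat.{0}}
    {b : W ⟶ Spec B} {w : W ⟶ Spec K} {f : A ⟶ B} {κ : A ⟶ K}
    (h : IsPushout f κ (gammaHom b) (gammaHom w)) :
    IsPullback b w (Spec.map f) (Spec.map κ) := by
  refine IsPullback.of_iso (isPullback_SpecMap_of_isPushout _ _ _ _ h) W.isoSpec.symm (Iso.refl _)
    (Iso.refl _) (Iso.refl _) ?_ ?_ (by simp) (by simp)
  · rw [Iso.refl_hom, Category.comp_id, Iso.symm_hom, Iso.eq_inv_comp]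
    exact toSpecΓ_gammaHom b
  · rw [Iso.refl_hom, Category.comp_id, Iso.symm_hom, Iso.eq_inv_comp]
    exact toSpecΓ_gammaHom w

end GlobalFunctions

/-! ### Pullbacks of the quotient family are cluster families, and determine the map -/

section Fibres

variable {n : ℕ} {G : Subgroup (GL (Fin n) ℂ)}

/-- The fibres of the quotient map, presented by a pushout square, are regular representations. -/
theorem exists_equiv_of_isPushout (hG : IsComplexReflectionGroup G) {K C : CommRingCat.{0}}
    (hK : IsField K) {κ : CommRingCat.of (invariants G) ⟶ K}
    {β : CommRingCat.of (MvPolynomial (Fin n) ℂ) ⟶ C} {δ : K ⟶ C}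
    (h : IsPushout (CommRingCat.ofHom (invariants G).val.toRingHom) κ β δ) {τ : G → (C ⟶ C)}
    (hβ : ∀ g, β ≫ τ g = CommRingCat.ofHom (groupSubst G g⁻¹).toRingHom ≫ β)
    (hδ : ∀ g, δ ≫ τ g = δ) :
    ∃ φ : C ≃+ MonoidAlgebra K G, (∀ c f, φ (δ.hom c * f) = c • φ f) ∧
      ∀ g f, φ ((τ g).hom f) = MonoidAlgebra.single g 1 * φ f := by
  let _ := hK.toField
  let _ : Algebra (invariants G) K := κ.hom.toAlgebra
  let _ : Algebra K C := δ.hom.toAlgebra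
  let _ : Algebra (MvPolynomial (Fin n) ℂ) C := β.hom.toAlgebra
  have : IsScalarTower (invariants G) K C := IsScalarTower.of_algebraMap_eq' 
    (congrArg CommRingCat.Hom.hom h.w)
  have hp : Algebra.IsPushout (invariants G) K (MvPolynomial (Fin n) ℂ) C :=
    CommRingCat.isPushout_iff_isPushout.mp h.flip
  let e := Algebra.IsPushout.equiv (invariants G) K (MvPolynomial (Fin n) ℂ) C
  obtain ⟨φ, hφ⟩ := exists_fibre_equiv_monoidAlgebra hG K
  have he (g : G) (x) : (τ g).hom (e x) = e ((groupSubst G g⁻¹).toLinearMap.baseChange K x) := by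
    induction x with
    | zero => simp
    | add x y hx hy => rw [map_add, map_add, map_add, map_add, hx, hy]
    | tmul c b =>
      rw [LinearMap.baseChange_tmul, Algebra.IsPushout.equiv_tmul, Algebra.IsPushout.equiv_tmul,
        map_mul]
      congr 1
      · exact congrArg (fun k => k.hom c) (hδ g)
      · exact congrArg (fun k => k.hom b) (hβ g)
  refine ⟨e.symm.toAddEquiv.trans φ.toAddEquiv, fun c f => ?_, fun g f => ?_⟩
  · change φ (e.symm (algebraMap K C c * f)) = c • φ (e.symm f)
    rw [← Algebra.smul_def, map_smul, map_smul]
  · change φ (e.symm _) = _ * φ (e.symm f)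
    rw [← hφ]
    congr 1
    rw [AlgEquiv.symm_apply_eq, ← he, AlgEquiv.apply_symm_apply]

theorem gammaHom_coord_comp_actSub {S : Over SpecC} {I : (prodAffine n S).IdealSheafData}
    (hI : IsInvariant G I) (g : G) :
    gammaHom (coord I) ≫ (actSub hI g).appTop =
      CommRingCat.ofHom (groupSubst G g).toRingHom ≫ gammaHom (coord I) := by
  refine (gammaHom_comp (actSub hI g) (coord I)).symm.trans ?_
  refine (congrArg gammaHom (actSub_coord hI g)).trans ?_
  exact gammaHom_SpecMap (coord I) (CommRingCat.ofHom (groupSubst G g).toRingHom)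

theorem isCluster_comap_quotientFamily (hG : IsComplexReflectionGroup G) {K : CommRingCat.{0}}
    (hK : IsField K) (t : Spec K ⟶ SpecC) (f : Over.mk t ⟶ quotientVariety G) :
    IsCluster G K t ((quotientFamily G).comap (baseChange n f)) := by
  have h := comap_quotientFamily_eq_iff.mp (rfl : (quotientFamily G).comap (baseChange n f) = _)
  set J := (quotientFamily G).comap (baseChange n f) with hJ
  have hinv : IsInvariant G J := isInvariant_quotientFamily.comap f
  obtain ⟨κ, hκ⟩ : ∃ κ : CommRingCat.of (invariants G) ⟶ K, Spec.map κ = f.left :=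
    ⟨Spec.preimage f.left, Spec.map_preimage _⟩
  have h' : IsPullback (coord J) (proj J)
      (Spec.map (CommRingCat.ofHom (invariants G).val.toRingHom)) (Spec.map κ) := by
    rw [hκ]; exact h
  obtain ⟨φ, h1, h2⟩ := exists_equiv_of_isPushout hG hK (isPushout_gammaHom_gammaHom h')
    (τ := fun g => (actSub hinv g⁻¹).appTop) (fun g => gammaHom_coord_comp_actSub hinv g⁻¹)
    (fun g => by rw [← gammaHom_comp]; exact congrArg gammaHom (actSub_proj hinv g⁻¹))
  exact ⟨hinv, φ, h1, h2⟩

theorem isFinite_quotientMap [Finite G] : IsFinite (quotientMap G).left :=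
  (IsFinite.SpecMap_iff _).mpr (RingHom.finite_algebraMap.mpr
    (inferInstanceAs (Module.Finite (invariants G) (MvPolynomial (Fin n) ℂ))))

theorem flat_quotientMap (hG : IsComplexReflectionGroup G) : Flat (quotientMap G).left :=
  Flat.SpecMap_iff.mpr (RingHom.flat_algebraMap_iff.mpr (flat_of_isComplexReflectionGroup hG))

theorem surjective_quotientMap [Finite G] : Surjective (quotientMap G).left := by
  refine ⟨?_⟩
  exact Algebra.IsIntegral.comap_surjective (R := invariants G) (S := MvPolynomial (Fin n) ℂ)

/-- Every pull-back of the universal family is a family of clusters. -/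
theorem isClusterFamily_comap_quotientFamily (hG : IsComplexReflectionGroup G) {S : Over SpecC}
    (f : S ⟶ quotientVariety G) :
    IsClusterFamily G S ((quotientFamily G).comap (baseChange n f)) := by
  have := hG.1
  have h := comap_quotientFamily_eq_iff.mp (rfl : (quotientFamily G).comap (baseChange n f) = _)
  refine ⟨isInvariant_quotientFamily.comap f, ?_, ?_, fun s => ?_⟩
  · exact MorphismProperty.of_isPullback h isFinite_quotientMap
  · exact MorphismProperty.of_isPullback h (flat_quotientMap hG)
  · rw [← Scheme.IdealSheafData.comap_comp, ← baseChange_comp]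
    exact isCluster_comap_quotientFamily hG (Field.toIsField _) _ _

/-- Two classifying maps of one family agree after composition with its projection to `S`, since
both composites are the coordinates followed by the quotient map. That projection is finite, flat
and surjective, hence an epimorphism. -/
theorem injective_comap_quotientFamily (hG : IsComplexReflectionGroup G) (S : Over SpecC) :
    Function.Injective fun f : S ⟶ quotientVariety G =>
      (quotientFamily G).comap (baseChange n f) := by
  intro f g hfg
  have := hG.1
  have hf := comap_quotientFamily_eq_iff.mp hfg
  have hg := comap_quotientFamily_eq_iff.mp (rfl : (quotientFamily G).comap (baseChange n g) = _)
  dsimp only at hf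
  have : Flat (proj ((quotientFamily G).comap (baseChange n g))) :=
    MorphismProperty.of_isPullback hg (flat_quotientMap hG)
  have : Surjective (proj ((quotientFamily G).comap (baseChange n g))) :=
    MorphismProperty.of_isPullback hg surjective_quotientMap
  have := Flat.epi_of_flat_of_surjective (proj ((quotientFamily G).comap (baseChange n g)))
  ext1
  rw [← cancel_epi (proj ((quotientFamily G).comap (baseChange n g))), ← hf.w, hg.w]

end Fibres

/-! ### Classifying maps over affine opens of the base -/

section AffineBase

variable {n : ℕ} {G : Subgroup (GL (Fin n) ℂ)}

theorem isRegularFibre_of_isCluster {A : CommRingCat.{0}} {u : Spec A ⟶ SpecC}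
    {I : (prodAffine n (Over.mk u)).IdealSheafData} (hI : IsInvariant G I) [IsFinite (proj I)]
    {K : CommRingCat.{0}} {t : Spec K ⟶ SpecC} {k : Over.mk t ⟶ Over.mk u} {κ : A ⟶ K}
    (hκ : Spec.map κ = k.left) (h : IsCluster G K t (I.comap (baseChange n k))) :
    IsRegularFibre (gammaHom (proj I)) (fun g : G => (actSub hI g⁻¹).appTop) κ
      (comapMap I k).appTop (gammaHom (proj (I.comap (baseChange n k)))) := by
  have : IsAffine (Over.mk u).left := inferInstanceAs (IsAffine (Spec A))
  have : IsAffine I.subscheme := isAffine_of_isAffineHom (proj I)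
  obtain ⟨hJ, φ, h1, h2⟩ := h
  refine ⟨isPushout_gammaHom (hκ ▸ isPullback_comapMap I k),
    fun g => (actSub hJ g⁻¹).appTop, φ, fun g => ?_, fun g => ?_, h1, h2⟩
  · rw [← Scheme.Hom.comp_appTop, ← Scheme.Hom.comp_appTop, actSub_comapMap hI]
  · rw [← gammaHom_comp]
    exact congrArg gammaHom (actSub_proj hJ g⁻¹)

theorem coord_comp_hom {S : Over SpecC} (I : (prodAffine n S).IdealSheafData) :
    coord I ≫ (affineSpace n).hom = proj I ≫ S.hom := by
  rw [coord, proj, Category.assoc, Category.assoc, pullback.condition]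

theorem closure_range_gammaHom_comp {Z P : Scheme.{0}} [IsAffine P] (i : Z ⟶ P)
    [IsClosedImmersion i] {A B : CommRingCat.{0}} {x : P ⟶ Spec A} {y : P ⟶ Spec B}
    (h : Subring.closure (Set.range (gammaHom x).hom ∪ Set.range (gammaHom y).hom) = ⊤) :
    Subring.closure (Set.range (gammaHom (i ≫ x)).hom ∪ Set.range (gammaHom (i ≫ y)).hom) = ⊤ := by
  have hs : Function.Surjective i.appTop.hom :=
    (IsClosedImmersion.isAffine_surjective_of_isAffine i).2
  rw [gammaHom_comp, gammaHom_comp, CommRingCat.hom_comp, CommRingCat.hom_comp, RingHom.coe_comp,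
    RingHom.coe_comp, Set.range_comp, Set.range_comp, ← Set.image_union, ← RingHom.map_closure, h,
    ← RingHom.range_eq_map, RingHom.range_eq_top.mpr hs]

/-- Functions on the affine product are generated by those of its factors, and they restrict
surjectively to a closed subscheme. This is how being embedded in `ℂⁿ` enters the affine argument.
-/
theorem closure_range_gammaHom {A : CommRingCat.{0}} {u : Spec A ⟶ SpecC}
    (I : (prodAffine n (Over.mk u)).IdealSheafData) :
    Subring.closure (Set.range (gammaHom (A := A) (proj I)).hom ∪
      Set.range (gammaHom (A := CommRingCat.of (MvPolynomial (Fin n) ℂ)) (coord I)).hom) = ⊤ := by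
  obtain ⟨c, rfl⟩ : ∃ c : CommRingCat.of ℂ ⟶ A, Spec.map c = u := ⟨_, Spec.map_preimage u⟩
  have : IsAffine (Over.mk (Spec.map c)).left := inferInstanceAs (IsAffine (Spec A))
  exact closure_range_gammaHom_comp I.subschemeι (closure_range_union_range_of_isPushout
    (isPushout_gammaHom_gammaHom (IsPullback.of_hasPullback (Spec.map c)
      (Spec.map (CommRingCat.ofHom (algebraMap ℂ (MvPolynomial (Fin n) ℂ)))))))

/-- An open immersion induces isomorphisms of residue fields. The cluster condition refers to
residue fields of the whole base, so these serve as the test fields over `A`. -/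
theorem exists_fromSpec_residueField {X : Scheme.{0}} {A : CommRingCat.{0}} (j : Spec A ⟶ X)
    [IsOpenImmersion j] (p : PrimeSpectrum A) :
    ∃ (s : X) (κ : A ⟶ X.residueField s),
      RingHom.ker κ.hom = p.asIdeal ∧ Spec.map κ ≫ j = X.fromSpecResidueField s := by
  let q : Spec A := p
  let k : Spec (X.residueField (j q)) ⟶ Spec A :=
    inv (Spec.map (j.residueFieldMap q)) ≫ (Spec A).fromSpecResidueField q
  refine ⟨j q, Spec.preimage k, ?_, ?_⟩
  · let z : Spec (X.residueField (j q)) := (⊥ : PrimeSpectrum (X.residueField (j q)))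
    have h : Spec.map (Spec.preimage k) z = q := by
      rw [Spec.map_preimage]
      simp only [k, Scheme.Hom.comp_apply, Scheme.fromSpecResidueField_apply]
    exact congrArg PrimeSpectrum.asIdeal h
  · rw [Spec.map_preimage, Category.assoc,
      ← Scheme.Hom.SpecMap_residueFieldMap_fromSpecResidueField, IsIso.inv_hom_id_assoc]

theorem surjective_of_comap_gammaHom_surjective {Z : Scheme.{0}} [IsAffine Z] {A : CommRingCat.{0}}
    (a : Z ⟶ Spec A) (h : Function.Surjective (PrimeSpectrum.comap (gammaHom a).hom)) :
    Surjective a := by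
  have : Surjective (Spec.map (gammaHom a)) := ⟨h⟩
  rw [← toSpecΓ_gammaHom a]
  infer_instance

/-- Families of clusters are locally on the base pulled back from the universal family. -/
theorem exists_isPullback_of_isOpenImmersion (hG : IsComplexReflectionGroup G) {S : Over SpecC}
    [IsLocallyNoetherian S.left] {I : (prodAffine n S).IdealSheafData} (hI : IsClusterFamily G S I)
    {A : CommRingCat.{0}} {u : Spec A ⟶ SpecC} (j : Over.mk u ⟶ S) [IsOpenImmersion j.left] :
    Surjective (proj (I.comap (baseChange n j))) ∧
    ∃ f : Over.mk u ⟶ quotientVariety G,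
      IsPullback (coord (I.comap (baseChange n j))) (proj (I.comap (baseChange n j)))
        (quotientMap G).left f.left := by
  have hfin : IsFinite (proj (I.comap (baseChange n j))) :=
    MorphismProperty.of_isPullback (isPullback_comapMap I j) hI.finite
  have hflat : Flat (proj (I.comap (baseChange n j))) :=
    MorphismProperty.of_isPullback (isPullback_comapMap I j) hI.flat
  have hinv := hI.invariant.comap j
  have : IsNoetherianRing A :=
    isLocallyNoetherian_Spec.mp (isLocallyNoetherian_of_isOpenImmersion j.left)
  have : IsAffine (Over.mk u).left := inferInstanceAs (IsAffine (Spec A))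
  have : IsAffine (I.comap (baseChange n j)).subscheme :=
    isAffine_of_isAffineHom (proj (I.comap (baseChange n j)))
  obtain ⟨c, hc⟩ : ∃ c : CommRingCat.of ℂ ⟶ A, Spec.map c = u := ⟨_, Spec.map_preimage u⟩
  have hcomm : CommRingCat.ofHom (algebraMap ℂ (MvPolynomial (Fin n) ℂ)) ≫
      gammaHom (A := CommRingCat.of (MvPolynomial (Fin n) ℂ)) (coord (I.comap (baseChange n j))) =
      c ≫ gammaHom (A := A) (proj (I.comap (baseChange n j))) := by
    refine (gammaHom_SpecMap _ _).symm.trans (Eq.trans ?_ (gammaHom_SpecMap _ _))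
    rw [hc]
    exact congrArg gammaHom (coord_comp_hom (I.comap (baseChange n j)))
  have hfinA : (gammaHom (A := A) (proj (I.comap (baseChange n j)))).hom.Finite := by
    have : (proj (I.comap (baseChange n j))).appTop.hom.Finite := Scheme.Hom.finite_appTop _
    exact this.comp (.of_surjective _
      (ConcreteCategory.bijective_of_isIso (Scheme.ΓSpecIso A).inv).surjective)
  have hflatA : (gammaHom (A := A) (proj (I.comap (baseChange n j)))).hom.Flat := by
    have : (proj (I.comap (baseChange n j))).appTop.hom.Flat := Scheme.Hom.flat_appTop _
    exact RingHom.Flat.comp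
      (.of_bijective (ConcreteCategory.bijective_of_isIso (Scheme.ΓSpecIso A).inv)) this
  obtain ⟨h1, ψ, h2, h3⟩ := exists_isPushout_of_isRegularFibre hG hfinA hflatA hcomm
    (closure_range_gammaHom (I.comap (baseChange n j))) (fun g => (actSub hinv g⁻¹).appTop)
    (fun g => by rw [← gammaHom_comp]; exact congrArg gammaHom (actSub_proj hinv g⁻¹))
    (fun g => gammaHom_coord_comp_actSub hinv g⁻¹) fun p => by
      obtain ⟨s, κ, hker, hκ⟩ := exists_fromSpec_residueField j.left p
      let k : Over.mk (S.left.fromSpecResidueField s ≫ S.hom) ⟶ Over.mk u :=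
        Over.homMk (Spec.map κ) (by
          rw [← hκ]
          simp)
      have hk : k ≫ j = pointMap S s := by
        ext1
        exact hκ
      refine ⟨S.left.residueField s, _, κ, _, _, Field.toIsField _, hker,
        isRegularFibre_of_isCluster hinv (k := k) rfl ?_⟩
      rw [← Scheme.IdealSheafData.comap_comp, ← baseChange_comp, hk]
      exact hI.fibre s
  refine ⟨surjective_of_comap_gammaHom_surjective _ h1, Over.homMk (Spec.map ψ) ?_, ?_⟩
  · change Spec.map ψ ≫ Spec.map _ = u
    rw [← Spec.map_comp, h2, hc]
  · exact isPullback_of_isPushout_gammaHom h3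

end AffineBase

/-! ### Descent to a global classifying map, and uniqueness -/

section Descent

/-- A commutative square of schemes is a fibre product if it is so locally on the base. -/
theorem isPullback_of_openCover {Z S X Y : Scheme.{0}} {b : Z ⟶ X} {a : Z ⟶ S} {p : X ⟶ Y}
    {f : S ⟶ Y} (w : b ≫ p = a ≫ f) (U : S.OpenCover)
    (h : ∀ i, ∃ (W : Scheme.{0}) (z : W ⟶ Z) (v : W ⟶ U.X i), IsPullback z v a (U.f i) ∧
      IsPullback (z ≫ b) v p (U.f i ≫ f)) : IsPullback b a p f := by
  let m : Z ⟶ pullback p f := pullback.lift b a w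
  have hm₁ : m ≫ pullback.fst p f = b := pullback.lift_fst _ _ _
  have hm₂ : m ≫ pullback.snd p f = a := pullback.lift_snd _ _ _
  suffices IsIso m from IsPullback.of_iso_pullback ⟨w⟩ (asIso m) hm₁ hm₂
  change MorphismProperty.isomorphisms Scheme m
  -- Being an isomorphism is local on the target, so the comparison map `m` is tested over the cover
  -- pulled back from `S`, where both sides are fibre products over `U.X i`.
  refine (IsZariskiLocalAtTarget.iff_of_openCover (P := MorphismProperty.isomorphisms Scheme)
    (U.pullback₁ (pullback.snd p f))).mpr fun i => ?_
  obtain ⟨W, z, v, h1, h2⟩ := h i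
  have hV : IsPullback (pullback.fst (pullback.snd p f) (U.f i))
      (pullback.snd (pullback.snd p f) (U.f i)) (pullback.snd p f) (U.f i) :=
    IsPullback.of_hasPullback _ _
  let e : W ⟶ pullback (pullback.snd p f) (U.f i) :=
    pullback.lift (z ≫ m) v (by rw [Category.assoc, hm₂, h1.w])
  have he₁ : e ≫ pullback.fst (pullback.snd p f) (U.f i) = z ≫ m := pullback.lift_fst _ _ _
  have he₂ : e ≫ pullback.snd (pullback.snd p f) (U.f i) = v := pullback.lift_snd _ _ _
  have he : IsIso e := by
    have hV' := hV.flip.paste_vert (IsPullback.of_hasPullback p f).flip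
    have : e = (h2.isoIsPullback _ _ hV'.flip).hom := by
      apply hV'.flip.hom_ext
      · rw [IsPullback.isoIsPullback_hom_fst]
        rw [reassoc_of% he₁, hm₁]
      · rw [IsPullback.isoIsPullback_hom_snd]
        exact he₂
    rw [this]
    infer_instance
  have htop : IsPullback z e m (pullback.fst (pullback.snd p f) (U.f i)) := by
    refine IsPullback.of_bot ?_ he₁.symm hV
    rwa [he₂, hm₂]
  change IsIso (pullback.snd m (pullback.fst (pullback.snd p f) (U.f i)))
  rw [← htop.isoPullback_inv_snd]
  infer_instance

variable {n : ℕ} {G : Subgroup (GL (Fin n) ℂ)}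

/-- Every family of clusters is pulled back from the universal family. -/
theorem exists_comap_quotientFamily_eq (hG : IsComplexReflectionGroup G) {S : Over SpecC}
    [IsLocallyNoetherian S.left] {I : (prodAffine n S).IdealSheafData}
    (hI : IsClusterFamily G S I) :
    ∃ f : S ⟶ quotientVariety G, (quotientFamily G).comap (baseChange n f) = I := by
  have := hI.finite
  have := hI.flat
  let U := S.left.affineOpenCover
  let j (i) : Over.mk (U.f i ≫ S.hom) ⟶ S := Over.homMk (U.f i)
  have hj (i) : IsOpenImmersion (j i).left := inferInstanceAs (IsOpenImmersion (U.f i))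
  have hloc (i) := exists_isPullback_of_isOpenImmersion hG hI (j i)
  have hs (i) : Surjective (proj (I.comap (baseChange n (j i)))) := (hloc i).1
  choose f hf using fun i => (hloc i).2
  have hZ (i) := isPullback_comapMap I (j i)
  have hsurj : Surjective (proj I) := by
    refine ⟨fun s => ?_⟩
    obtain ⟨i, x, rfl⟩ := U.openCover.exists_eq s
    obtain ⟨z, rfl⟩ := (hs i).surj x
    refine ⟨comapMap I (j i) z, ?_⟩
    exact congrArg (fun k => k z) (hZ i).w
  -- This is the descent condition. Over each chart the map to the quotient factors through the
  -- projection via `f i`, so it depends only on the point of the base.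
  have hdesc : ∀ {W : Scheme.{0}} (g₁ g₂ : W ⟶ I.subscheme), g₁ ≫ proj I = g₂ ≫ proj I →
      g₁ ≫ coord I ≫ (quotientMap G).left = g₂ ≫ coord I ≫ (quotientMap G).left := by
    intro W g₁ g₂ hg
    refine Scheme.Cover.hom_ext (U.openCover.pullback₁ (g₁ ≫ proj I)) _ _ fun i => ?_
    let v := pullback.fst (g₁ ≫ proj I) (U.f i)
    let w := pullback.snd (g₁ ≫ proj I) (U.f i)
    have hv : v ≫ g₁ ≫ proj I = w ≫ U.f i := pullback.condition
    have key (g : W ⟶ I.subscheme) (hg : v ≫ g ≫ proj I = w ≫ U.f i) :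
        v ≫ g ≫ coord I ≫ (quotientMap G).left = w ≫ (f i).left := by
      have h1 := (hZ i).lift_fst (v ≫ g) w (by rw [Category.assoc]; exact hg)
      have h2 := (hZ i).lift_snd (v ≫ g) w (by rw [Category.assoc]; exact hg)
      rw [← Category.assoc, ← h1, Category.assoc, comapMap_coord_assoc, (hf i).w, reassoc_of% h2]
    exact (key g₁ hv).trans (key g₂ (hg ▸ hv)).symm
  -- The projection is flat, surjective and finite, so maps descend along it; the local `f i` need
  -- not be glued by hand.
  have : EffectiveEpi (proj I) := inferInstance
  let f₀ : S.left ⟶ (quotientVariety G).left :=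
    EffectiveEpi.desc (proj I) (coord I ≫ (quotientMap G).left) hdesc
  have hf₀ : proj I ≫ f₀ = coord I ≫ (quotientMap G).left :=
    EffectiveEpi.fac (proj I) (coord I ≫ (quotientMap G).left) hdesc
  have hover : f₀ ≫ (quotientVariety G).hom = S.hom := by
    rw [← cancel_epi (proj I), reassoc_of% hf₀, Over.w, coord_comp_hom]
  refine ⟨Over.homMk f₀ hover, comap_quotientFamily_eq_iff.mpr ?_⟩
  refine isPullback_of_openCover hf₀.symm U.openCover fun i =>
    ⟨_, comapMap I (j i), proj (I.comap (baseChange n (j i))), hZ i, ?_⟩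
  have : Flat (proj (I.comap (baseChange n (j i)))) := MorphismProperty.of_isPullback (hZ i) hI.flat
  have : Surjective (proj (I.comap (baseChange n (j i)))) := hs i
  have := Flat.epi_of_flat_of_surjective (proj (I.comap (baseChange n (j i))))
  -- The local classifying map is the restriction of the descended one, because the two agree after
  -- the epimorphic projection of the restricted family.
  have hfi : (f i).left = U.f i ≫ f₀ := by
    rw [← cancel_epi (proj (I.comap (baseChange n (j i)))), ← (hf i).w, ← comapMap_coord,
      Category.assoc, ← hf₀]
    exact (hZ i).w_assoc f₀
  rw [comapMap_coord]
  exact hfi ▸ hf i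

theorem isGHilbertScheme_quotientVariety (hG : IsComplexReflectionGroup G) :
    IsGHilbertScheme G (quotientVariety G) (quotientFamily G) where
  locallyNoetherian := by
    have := hG.1
    exact inferInstanceAs (IsLocallyNoetherian (Spec (CommRingCat.of (invariants G))))
  bijOn S _ := ⟨fun f _ => isClusterFamily_comap_quotientFamily hG f,
    (injective_comap_quotientFamily hG S).injOn, fun _ hI =>
      let ⟨f, hf⟩ := exists_comap_quotientFamily_eq hG hI
      ⟨f, Set.mem_univ f, hf⟩⟩

/-- Pairs representing the functor of families of clusters are uniquely isomorphic. -/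
theorem IsGHilbertScheme.existsUnique_iso {X Y : Over SpecC}
    {Z : (prodAffine n X).IdealSheafData} {W : (prodAffine n Y).IdealSheafData}
    (hX : IsGHilbertScheme G X Z) (hY : IsGHilbertScheme G Y W) :
    ∃! e : X ≅ Y, W.comap (baseChange n e.hom) = Z := by
  have hid {V : Over SpecC} (C : (prodAffine n V).IdealSheafData) :
      C.comap (baseChange n (𝟙 V)) = C := by
    rw [baseChange_id, Scheme.IdealSheafData.comap_id]
  have hcomp {U V T : Over SpecC} (C : (prodAffine n T).IdealSheafData) (f : U ⟶ V) (g : V ⟶ T) :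
      C.comap (baseChange n (f ≫ g)) = (C.comap (baseChange n g)).comap (baseChange n f) := by
    rw [baseChange_comp, Scheme.IdealSheafData.comap_comp]
  -- The universal family is its own pullback along the identity, hence a member of the functor;
  -- each pair then classifies the family of the other.
  have hZ : IsClusterFamily G X Z :=
    hid Z ▸ (hX.bijOn X hX.locallyNoetherian).mapsTo (Set.mem_univ (𝟙 X))
  have hW : IsClusterFamily G Y W :=
    hid W ▸ (hY.bijOn Y hY.locallyNoetherian).mapsTo (Set.mem_univ (𝟙 Y))
  obtain ⟨f, -, hf⟩ := (hY.bijOn X hX.locallyNoetherian).surjOn hZ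
  obtain ⟨g, -, hg⟩ := (hX.bijOn Y hY.locallyNoetherian).surjOn hW
  dsimp only at hf hg
  have hfg : f ≫ g = 𝟙 X := by
    refine (hX.bijOn X hX.locallyNoetherian).injOn (Set.mem_univ _) (Set.mem_univ _) ?_
    rw [hcomp, hg, hf, hid]
  have hgf : g ≫ f = 𝟙 Y := by
    refine (hY.bijOn Y hY.locallyNoetherian).injOn (Set.mem_univ _) (Set.mem_univ _) ?_
    rw [hcomp, hf, hg, hid]
  refine ⟨⟨f, g, hfg, hgf⟩, hf, fun e he => Iso.ext ?_⟩
  exact (hY.bijOn X hX.locallyNoetherian).injOn (Set.mem_univ _) (Set.mem_univ _) (he.trans hf.symm)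

end Descent

end GHilb

end

theorem lemma3p8 (n : ℕ) (G : Subgroup (Matrix.GeneralLinearGroup (Fin n) ℂ))
    (hG : GHilb.IsComplexReflectionGroup G) :
    GHilb.IsGHilbertScheme G (GHilb.quotientVariety G) (GHilb.quotientFamily G) ∧
    ∀ (X : CategoryTheory.Over GHilb.SpecC) (Z : (GHilb.prodAffine n X).IdealSheafData),
      GHilb.IsGHilbertScheme G X Z →
      ∃! e : X ≅ GHilb.quotientVariety G,
        (GHilb.quotientFamily G).comap (GHilb.baseChange n e.hom) = Z :=
  ⟨GHilb.isGHilbertScheme_quotientVariety hG,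
    fun _ _ h => h.existsUnique_iso (GHilb.isGHilbertScheme_quotientVariety hG)⟩
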